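/- **Setting.** Let $Q^\mu$ (multiplication by $q^\mu$) and $P^\mu=-i\,\partial/\partial q^\mu$, $\mu=0,\dots,3$, act on $\mathscr S(\mathbb R^4)\subset L^2(\mathbb R^4)$, so that $[Q^\mu,P^\nu]=i\delta^{\mu\nu}$. Let $\eta=\mathrm{diag}(1,-1,-1,-1)$, let $a^\mu\neq0$ be real, $a_\mu=\eta_{\mu\nu}a^\nu$ (so $a_0=a^0$, $a_i=-a^i$), and let $q\ne 0$ be a real vector. The algebra $[\hat x^\mu,\hat x^\nu]=0$, $[\hat x^\mu,d\hat x^\nu]=ia^\mu\delta^{\mu\nu}d\hat x^\nu$ is represented on $\mathscr S(\mathbb R^4)$ by $$X^\mu=\tfrac{a^\mu}{2}(Q^\mu P^\mu+P^\mu Q^\mu),\qquad dX^\mu=i\sum_b q_b[P^b,X^\mu].$$ Let $U(p)=\exp(ip_\mu X^\mu)$ and $\alpha_p(A)=U(p)AU(p)^{-1}$. For a real skew-symmetric matrix $\Theta=(\Theta_{\mu\nu})$, with $(\Theta x)_\mu=\Theta_{\mu\nu}x^\nu$, and an operator $A$ on $\mathscr S(\mathbb R^4)$, the warped convolution is $$A_\Theta\varphi=(2\pi)^{-4}\lim_{\varepsilon\to0^+}\iint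 dx\,dy\,\chi(\varepsilon x,\varepsilon y)\,e^{-ixy}\,\alpha_{\Theta x}(A)\,U(y)\varphi ,\qquad \chi(x,y)=e^{-s|x|^2-t|y|^2},$$ defined on those $\varphi\in\mathscr S(\mathbb R^4)$ for which, for all $s,t>0$, the integrals converge absolutely and the limit exists in $L^2(\mathbb R^4)$ and is independent of $s,t>0$. For a real function $f$ on $\mathbb R^4$, $f(X)=f(X^0,\dots,X^3)$ is defined by the joint spectral calculus of the commuting self-adjoint closures of the $X^\mu$. The deformed line-element is $(ds^2)_\Theta=(\eta_{\mu\nu}\,dX^\mu dX^\nu)_\Theta$. A matrix function $g_{\mu\nu}$ on $\mathbb R^4$ is called the deformed metric if, for all $\mu,\nu$, $(\eta_{\mu\nu}\,dX^\mu dX^\nu)_\Theta=g_{\mu\nu}(X)\,dX^\mu dX^\nu$, with equality of domains in $\mathscr S(\mathbb R^4)$, and $(ds^2)_\Theta=g_{\mu\nu}(X)\,dX^\mu dX^\nu$ on the natural domain of the right-hand side. **Theorem.** Let $H\in\mathbb R$, and let $q$, the spatial parameters $a^i\ne0$ $(i=1,2,3)$ and $\Theta$ be fixed, with $$2a_i\Theta_{0i}=-H\quad\text{(no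 sum)},\qquad \Theta_{ij}=0\qquad(i,j=1,2,3).$$ Then for every $a^0\neq0$ the deformed metric is $$g=\mathrm{diag}\bigl(e^{-2a_0\sum_i\Theta_{0i}x^i},\,-e^{Hx^0},\,-e^{Hx^0},\,-e^{Hx^0}\bigr),$$ and in the regime $a_0\Theta_{0i}\approx0$ this is the Friedmann-Robertson-Walker (de Sitter) metric $g^{\mathrm{FRW}}=\mathrm{diag}(1,-e^{Ht},-e^{Ht},-e^{Ht})$, $t=x^0$, of the line-element $ds^2=dt^2-e^{Ht}d\mathbf x^2$, in the following sense. Let $(a^0_k)_k$ be a family of non-zero reals with $a_{0,k}\Theta_{0i}\to0$ for $i=1,2,3$ along some filter, and let $g^{(k)}$ and $X_k$, $dX_k$ be the corresponding $g$, $X$, $dX$. 1. $g^{(k)}\to g^{\mathrm{FRW}}$ locally uniformly on $\mathbb R^4$; all components except the time-time component agree exactly with those of $g^{\mathrm{FRW}}$. 2. If $\psi\in\mathscr S(\mathbb R^4)$ is eventually in the domain of $g^{(k)}_{00}(X_k)$, then $g^{(k)}_{00}(X_k)\psi\to\psi$ in $L^2(\mathbb R^4)$. 3. If $\varphi\in\mathscr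 S(\mathbb R^4)$ is eventually in the natural domains of both line-elements, then $$(a_{0,k})^{-2}\Bigl(g^{(k)}_{\mu\nu}(X_k)\,dX_k^\mu dX_k^\nu\varphi-g^{\mathrm{FRW}}_{\mu\nu}(X_k)\,dX_k^\mu dX_k^\nu\varphi\Bigr)\to0\quad\text{in }L^2(\mathbb R^4).$$ The set of $\varphi\in\mathscr S(\mathbb R^4)$ that lie in the natural domain of $g^{(k)}_{\mu\nu}(X_k)dX_k^\mu dX_k^\nu$ and in the domain of $g^{(k)}_{00}(X_k)$ for all $k$ is dense in $L^2(\mathbb R^4)$. -/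

import Mathlib

open MeasureTheory Filter Topology
open scoped SchwartzMap

noncomputable section

namespace WarpedFRW

/-! ### Schrödinger representation and the representation of the differential algebra -/

/-- Points of `ℝ⁴`. Coordinates are numbered `0, 1, 2, 3`, the index `0` being time. -/
abbrev R4 : Type := Fin 4 → ℝ

/-- The common dense stable domain `𝒮(ℝ⁴)` of all undeformed operators. -/
abbrev Dom : Type := 𝓢(R4, ℂ)

/-- The Hilbert space `L²(ℝ⁴)`. -/
abbrev Hilb : Type := Lp ℂ 2 (volume : Measure R4)

/-- The inclusion `𝒮(ℝ⁴) ⊆ L²(ℝ⁴)`. -/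
def incl : Dom →L[ℂ] Hilb := SchwartzMap.toLpCLM ℂ ℂ 2 (volume : Measure R4)

/-- `Q^b`, multiplication by the coordinate `q^b`. -/
def Q (b : Fin 4) : Dom →L[ℂ] Dom :=
  SchwartzMap.smulLeftCLM ℂ (fun x : R4 => (x b : ℂ))

/-- `P^b = -i ∂/∂q^b`, so that `[Q^b, P^c] = i δ^{bc}`. -/
def P (b : Fin 4) : Dom →L[ℂ] Dom :=
  (-Complex.I) • LineDeriv.lineDerivOpCLM ℂ Dom (Pi.single b (1 : ℝ) : R4)

/-- `π(x̂^μ) = X^μ = (a^μ / 2) (Q^μ P^μ + P^μ Q^μ)`. -/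
def X (a : R4) (μ : Fin 4) : Dom →L[ℂ] Dom :=
  ((a μ : ℂ) / 2) • (Q μ * P μ + P μ * Q μ)

/-- `π(dx̂^μ) = dX^μ = i q_b [P^b, X^μ]` (sum over `b`). -/
def dX (a q : R4) (μ : Fin 4) : Dom →L[ℂ] Dom :=
  Complex.I • ∑ b, (q b : ℂ) • (P b * X a μ - X a μ * P b)

/-- The Minkowski metric `η = diag(1, -1, -1, -1)`. -/
def η : Matrix (Fin 4) (Fin 4) ℝ := Matrix.diagonal ![1, -1, -1, -1]

/-- Lowering an index with the Minkowski metric: `a_μ = η_{μν} a^ν`. -/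
def lower (a : R4) (μ : Fin 4) : ℝ := ∑ ν, η μ ν * a ν

/-- The flat line-element `ds² = η_{μν} dx̂^μ dx̂^ν` in the representation. -/
def flatLineElement (a q : R4) : Dom →L[ℂ] Dom :=
  ∑ μ, ∑ ν, (η μ ν : ℂ) • (dX a q μ * dX a q ν)

/-! ### The unitary group `U(p) = exp(i p_μ X^μ)` -/

/-- The coordinatewise dilation `x ↦ (e^{a^μ p_μ} x^μ)_μ`. -/
def dilation (a p : R4) : R4 ≃L[ℝ] R4 :=
  ContinuousLinearEquiv.piCongrRight fun μ =>
    ContinuousLinearEquiv.smulLeft (Units.mk0 (Real.exp (a μ * p μ)) (Real.exp_ne_zero _))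

/-- `U(p) = exp(i p_μ X^μ)` on `𝒮(ℝ⁴)`. Since `X^μ` generates dilations of the `μ`-th coordinate,
`(U(p) φ)(x) = e^{½ Σ_μ a^μ p_μ} φ((e^{a^μ p_μ} x^μ)_μ)`. -/
def U (a p : R4) : Dom →L[ℂ] Dom :=
  ((Real.exp ((∑ μ, a μ * p μ) / 2) : ℝ) : ℂ) •
    SchwartzMap.compCLMOfContinuousLinearEquiv ℂ (dilation a p)

/-- The adjoint action `α_p(A) = U(p) A U(p)⁻¹`. -/
def adjointAction (a p : R4) (A : Dom →L[ℂ] Dom) : Dom →L[ℂ] Dom :=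
  U a p * A * U a (-p)

/-! ### Warped convolution -/

/-- The integrand `χ(εx, εy) e^{-ixy} α_{Θx}(A) U(y) φ` of the oscillatory integral, with the
cut-off function `χ(x, y) = exp(-s|x|² - t|y|²)`. -/
def warpedIntegrand (a : R4) (Θ : Matrix (Fin 4) (Fin 4) ℝ) (A : Dom →L[ℂ] Dom) (φ : Dom)
    (s t ε : ℝ) (z : R4 × R4) : Hilb :=
  (((Real.exp (-s * ∑ μ, (ε * z.1 μ) ^ 2 - t * ∑ μ, (ε * z.2 μ) ^ 2) : ℝ) : ℂ) *
      Complex.exp (-Complex.I * ((∑ μ, z.1 μ * z.2 μ : ℝ) : ℂ))) •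
    incl (adjointAction a (Θ.mulVec z.1) A (U a z.2 φ))

/-- `HasWarpedConv a Θ A φ ξ` says that `φ` is in the domain of the warped convolution `A_Θ`
and `A_Θ φ = ξ`, where
`A_Θ φ = (2π)⁻⁴ lim_{ε → 0} ∬ dx dy χ(εx, εy) e^{-ixy} α_{Θx}(A) U(y) φ`.
The limit is taken in the Hilbert space norm, and has to be the same for all Gaussian cut-off
functions `χ`. -/
def HasWarpedConv (a : R4) (Θ : Matrix (Fin 4) (Fin 4) ℝ) (A : Dom →L[ℂ] Dom)
    (φ : Dom) (ξ : Hilb) : Prop :=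
  ∀ s t : ℝ, 0 < s → 0 < t →
    (∀ ε : ℝ, 0 < ε → Integrable (warpedIntegrand a Θ A φ s t ε)) ∧
    Tendsto (fun ε : ℝ => (((2 * Real.pi) ^ 4)⁻¹ : ℝ) • ∫ z, warpedIntegrand a Θ A φ s t ε z)
      (𝓝[>] 0) (𝓝 ξ)

/-! ### Functions of the commuting operators `X⁰, …, X³` -/

/-- `m` is the (joint) spectral measure `⟨ψ, E(·) ψ⟩` of the commuting self-adjoint operators
`X⁰, …, X³` in the vector `ψ`: `⟨ψ, U(p) ψ⟩ = ∫ e^{i p·x} dm(x)` for all `p`. -/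
def IsSpectralMeasure (a : R4) (ψ : Dom) (m : Measure R4) : Prop :=
  IsFiniteMeasure m ∧ ∀ p : R4,
    inner ℂ (incl ψ) (incl (U a p ψ)) =
      ∫ x, Complex.exp (Complex.I * ((∑ μ, p μ * x μ : ℝ) : ℂ)) ∂m

/-- `HasFun a f ψ ξ` says that `ψ` is in the domain of the operator `f(X⁰, …, X³)` given by the
spectral calculus, i.e. `∫ |f|² d⟨ψ, E ψ⟩ < ∞`, and that `f(X⁰, …, X³) ψ = ξ`. The vector `ξ` is
determined by `⟨U(p) ψ, ξ⟩ = ∫ e^{-i p·x} f(x) d⟨ψ, E(x) ψ⟩` for all `p`, which fixes its component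
in the cyclic subspace of `ψ`, and by `‖ξ‖² = ∫ |f|² d⟨ψ, E ψ⟩`, which says that it has no
other component. -/
def HasFun (a : R4) (f : R4 → ℝ) (ψ : Dom) (ξ : Hilb) : Prop :=
  ∃ m : Measure R4, IsSpectralMeasure a ψ m ∧ MemLp f 2 m ∧
    (∀ p : R4, inner ℂ (incl (U a p ψ)) ξ =
      ∫ x, Complex.exp (-Complex.I * ((∑ μ, p μ * x μ : ℝ) : ℂ)) * (f x : ℂ) ∂m) ∧
    ‖ξ‖ ^ 2 = ∫ x, f x ^ 2 ∂m

/-- `HasLineElement a q g φ ξ` says that `φ` is in the (natural) domain of the line-element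
`g_{μν}(X) dX^μ dX^ν` and that `g_{μν}(X) dX^μ dX^ν φ = ξ`. -/
def HasLineElement (a q : R4) (g : R4 → Matrix (Fin 4) (Fin 4) ℝ) (φ : Dom) (ξ : Hilb) : Prop :=
  ∃ ζ : Fin 4 → Fin 4 → Hilb,
    (∀ μ ν, HasFun a (fun x => g x μ ν) ((dX a q μ * dX a q ν) φ) (ζ μ ν)) ∧
    ξ = ∑ μ, ∑ ν, ζ μ ν

/-- The metric obtained from the flat one by the deformation is `g(X)`: for all `μ, ν`, the
deformation of `η_{μν} dX^μ dX^ν` is `g_{μν}(X) dX^μ dX^ν`, with the same domain, and the deformed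
line-element `(ds²)_Θ = (η_{μν} dX^μ dX^ν)_Θ` is `g_{μν}(X) dX^μ dX^ν`. -/
def IsDeformedMetric (a q : R4) (Θ : Matrix (Fin 4) (Fin 4) ℝ)
    (g : R4 → Matrix (Fin 4) (Fin 4) ℝ) : Prop :=
  (∀ μ ν φ ξ, HasWarpedConv a Θ ((η μ ν : ℂ) • (dX a q μ * dX a q ν)) φ ξ ↔
    HasFun a (fun x => g x μ ν) ((dX a q μ * dX a q ν) φ) ξ) ∧
  ∀ φ ξ, HasLineElement a q g φ ξ → HasWarpedConv a Θ (flatLineElement a q) φ ξ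

/-- The Friedmann-Robertson-Walker metric `diag(1, -e^{Ht}, -e^{Ht}, -e^{Ht})`, `t = x⁰`. -/
def frwMetric (H : ℝ) (x : R4) : Matrix (Fin 4) (Fin 4) ℝ :=
  Matrix.diagonal ![1, -Real.exp (H * x 0), -Real.exp (H * x 0), -Real.exp (H * x 0)]

/-! ### Basic facts confirming the definitions -/

theorem Q_apply (b : Fin 4) (φ : Dom) (x : R4) : Q b φ x = (x b : ℂ) * φ x := by
  have h : (fun x : R4 => (x b : ℂ)).HasTemperateGrowth :=
    (Complex.ofRealCLM.comp (ContinuousLinearMap.proj (R := ℝ) (φ := fun _ : Fin 4 => ℝ) b)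
      ).hasTemperateGrowth
  simp [Q, SchwartzMap.smulLeftCLM_apply_apply h]

theorem P_apply (b : Fin 4) (φ : Dom) (x : R4) :
    P b φ x = -Complex.I * fderiv ℝ φ x (Pi.single b 1) := by
  simp [P, SchwartzMap.lineDerivOp_apply_eq_fderiv]

theorem U_apply (a p : R4) (φ : Dom) (x : R4) :
    U a p φ x = ((Real.exp ((∑ μ, a μ * p μ) / 2) : ℝ) : ℂ) *
      φ (fun μ => Real.exp (a μ * p μ) * x μ) := by
  rfl

/-- The canonical commutation relations `[Q^b, P^c] = i δ^{bc}`. -/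
theorem Q_mul_P_sub (b c : Fin 4) :
    Q b * P c - P c * Q b = if b = c then Complex.I • (1 : Dom →L[ℂ] Dom) else 0 := by
  ext φ x
  have hQ : (Q b φ : R4 → ℂ) = fun y => (y b : ℂ) * φ y := funext fun y => Q_apply b φ y
  have h1 : HasFDerivAt (fun y : R4 => (y b : ℂ))
      (Complex.ofRealCLM.comp (ContinuousLinearMap.proj (R := ℝ) (φ := fun _ : Fin 4 => ℝ) b)) x :=
    (Complex.ofRealCLM.comp
      (ContinuousLinearMap.proj (R := ℝ) (φ := fun _ : Fin 4 => ℝ) b)).hasFDerivAt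
  have h2 : HasFDerivAt φ (fderiv ℝ φ x) x := φ.differentiableAt.hasFDerivAt
  have h3 : P c (Q b φ) x = -Complex.I * ((x b : ℂ) * fderiv ℝ φ x (Pi.single c 1) +
      φ x * ((Pi.single c (1 : ℝ) : R4) b : ℂ)) := by
    have h12 : HasFDerivAt (fun y : R4 => (y b : ℂ) * φ y) _ x := h1.mul h2
    rw [P_apply, hQ, h12.fderiv]
    simp
  have h4 : (Q b * P c - P c * Q b) φ x = Q b (P c φ) x - P c (Q b φ) x := rfl
  rw [h4, h3, Q_apply, P_apply]
  by_cases h : b = c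
  · subst h
    simp
    ring
  · simp [h]
    ring

theorem P_mul_P (b c : Fin 4) : P b * P c = P c * P b := by
  ext φ x
  have h (b c : Fin 4) : (P b * P c) φ x =
      -(fderiv ℝ (fderiv ℝ φ) x (Pi.single b 1) (Pi.single c 1)) := by
    have hP : (P c φ : R4 → ℂ) = fun y => -Complex.I * fderiv ℝ φ y (Pi.single c 1) :=
      funext fun y => P_apply c φ y
    have hd : DifferentiableAt ℝ (fderiv ℝ φ) x :=
      ((φ.smooth 2).fderiv_right (m := 1) (by norm_num)).differentiable (by norm_num) x
    have h1 : HasFDerivAt (fun y => fderiv ℝ φ y (Pi.single c (1 : ℝ) : R4))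
        ((fderiv ℝ (fderiv ℝ φ) x).flip (Pi.single c 1)) x := by
      simpa using hd.hasFDerivAt.clm_apply (hasFDerivAt_const (Pi.single c (1 : ℝ) : R4) x)
    have h0 : (P b * P c) φ x = P b (P c φ) x := rfl
    rw [h0, P_apply, hP, (h1.const_mul (-Complex.I)).fderiv]
    simp [← mul_assoc]
  rw [h, h]
  have hs : IsSymmSndFDerivAt ℝ φ x :=
    (φ.smooth 2).contDiffAt.isSymmSndFDerivAt (by simp)
  rw [hs.eq]

theorem X_eq (a : R4) (μ : Fin 4) :
    X a μ = (a μ : ℂ) • (Q μ * P μ) - (Complex.I * (a μ : ℂ) / 2) • (1 : Dom →L[ℂ] Dom) := by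
  have h : P μ * Q μ = Q μ * P μ - Complex.I • (1 : Dom →L[ℂ] Dom) := by
    have := Q_mul_P_sub μ μ
    rw [if_pos rfl] at this
    rw [← this]
    abel
  rw [X, h]
  module

/-- `X^μ` is the infinitesimal generator: `d/ds U(s p) φ |_{s = 0} = i p_μ X^μ φ`. -/
theorem hasDerivAt_U (a p : R4) (φ : Dom) (x : R4) :
    HasDerivAt (fun s : ℝ => U a (s • p) φ x)
      (Complex.I * ∑ μ, (p μ : ℂ) * X a μ φ x) 0 := by
  have hX (μ : Fin 4) : X a μ φ x = -Complex.I * (a μ : ℂ) *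
      ((x μ : ℂ) * fderiv ℝ φ x (Pi.single μ 1) + φ x / 2) := by
    have : X a μ φ x = (a μ : ℂ) * Q μ (P μ φ) x - (Complex.I * (a μ : ℂ) / 2) * φ x := by
      rw [X_eq]; rfl
    rw [this, Q_apply, P_apply]
    ring
  have h1 : HasDerivAt (fun s : ℝ => ((Real.exp ((∑ μ, a μ * (s • p) μ) / 2) : ℝ) : ℂ))
      (((∑ μ, a μ * p μ) / 2 : ℝ) : ℂ) 0 := by
    have hf : (fun s : ℝ => (∑ μ, a μ * (s • p) μ) / 2) =
        fun s : ℝ => s * ((∑ μ, a μ * p μ) / 2) := by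
      funext s
      simp only [Pi.smul_apply, smul_eq_mul, Finset.sum_div, Finset.mul_sum]
      exact Finset.sum_congr rfl fun μ _ => by ring
    have h := (((hasDerivAt_id (0 : ℝ)).mul_const ((∑ μ, a μ * p μ) / 2)).exp).ofReal_comp
    simp only [id, zero_mul, Real.exp_zero, one_mul] at h
    convert h using 1
    funext s
    rw [congrFun hf s]
  have h2 : HasDerivAt (fun s : ℝ => (fun μ => Real.exp (a μ * (s • p) μ) * x μ : R4))
      (fun μ => a μ * p μ * x μ) 0 := by
    rw [hasDerivAt_pi]
    intro μ
    have h := (((hasDerivAt_id (0 : ℝ)).mul_const (a μ * p μ)).exp).mul_const (x μ)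
    simp only [id, zero_mul, Real.exp_zero, one_mul] at h
    have hf : (fun s : ℝ => Real.exp (a μ * (s • p) μ) * x μ) =
        fun s : ℝ => Real.exp (s * (a μ * p μ)) * x μ := by
      funext s
      simp only [Pi.smul_apply, smul_eq_mul]
      ring_nf
    rw [hf]
    exact h
  have hx : (fun μ => Real.exp (a μ * ((0 : ℝ) • p) μ) * x μ : R4) = x := by
    funext μ; simp
  have h3 : HasFDerivAt φ (fderiv ℝ φ x)
      (fun μ => Real.exp (a μ * ((0 : ℝ) • p) μ) * x μ : R4) := by
    rw [hx]; exact φ.differentiableAt.hasFDerivAt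
  have h4 := h1.mul (h3.comp_hasDerivAt (0 : ℝ) h2)
  have h5 : fderiv ℝ φ x (fun μ => a μ * p μ * x μ) =
      ∑ μ, ((a μ * p μ * x μ : ℝ) : ℂ) * fderiv ℝ φ x (Pi.single μ 1) := by
    conv_lhs => rw [pi_eq_sum_univ' (fun μ => a μ * p μ * x μ)]
    rw [map_sum]
    refine Finset.sum_congr rfl fun μ _ => ?_
    rw [map_smul, Complex.real_smul]
  refine h4.congr_deriv ?_
  simp only [Function.comp_apply]
  rw [hx, h5]
  simp only [hX]
  push_cast
  simp only [Finset.mul_sum, Finset.sum_mul, Finset.sum_div, zero_smul, Pi.zero_apply, mul_zero,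
    Finset.sum_const_zero, zero_div, Complex.ofReal_zero, Complex.exp_zero, one_mul]
  rw [← Finset.sum_add_distrib]
  refine Finset.sum_congr rfl fun μ _ => ?_
  linear_combination ((p μ : ℂ) * (a μ : ℂ) *
      ((x μ : ℂ) * fderiv ℝ φ x (Pi.single μ 1) + φ x / 2)) * Complex.I_mul_I

/-- `dX^μ = q_μ a^μ P^μ`. -/
theorem dX_eq (a q : R4) (μ : Fin 4) :
    dX a q μ = ((q μ : ℂ) * (a μ : ℂ)) • P μ := by
  have h (b : Fin 4) : P b * X a μ - X a μ * P b =
      if b = μ then (-Complex.I * (a μ : ℂ)) • P μ else 0 := by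
    have e : P b * X a μ - X a μ * P b = -((a μ : ℂ) • ((Q μ * P b - P b * Q μ) * P μ)) := by
      rw [X_eq]
      simp only [mul_sub, sub_mul, mul_smul_comm, smul_mul_assoc, mul_one, one_mul, mul_assoc,
        P_mul_P μ b]
      module
    rw [e, Q_mul_P_sub]
    by_cases hb : b = μ
    · subst hb
      simp only [if_true, smul_mul_assoc, one_mul]
      module
    · simp [hb, Ne.symm hb]
  rw [dX, Finset.sum_eq_single μ]
  · rw [h, if_pos rfl, smul_smul, smul_smul]
    congr 1
    linear_combination (-(q μ : ℂ) * (a μ : ℂ)) * Complex.I_mul_I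
  · intro b _ hb
    rw [h, if_neg hb, smul_zero]
  · simp

/-- The relations `[X^μ, dX^ν] = i a^μ δ^{μν} dX^ν` of the deformed differential algebra. -/
theorem X_mul_dX_sub (a q : R4) (μ ν : Fin 4) :
    X a μ * dX a q ν - dX a q ν * X a μ =
      if μ = ν then (Complex.I * (a μ : ℂ)) • dX a q ν else 0 := by
  have e : X a μ * dX a q ν - dX a q ν * X a μ =
      ((q ν : ℂ) * (a ν : ℂ) * (a μ : ℂ)) • ((Q μ * P ν - P ν * Q μ) * P μ) := by
    rw [X_eq, dX_eq]
    simp only [mul_sub, sub_mul, mul_smul_comm, smul_mul_assoc, mul_one, one_mul, mul_assoc,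
      P_mul_P μ ν]
    module
  rw [e, Q_mul_P_sub]
  by_cases h : μ = ν
  · subst h
    simp only [if_true, smul_mul_assoc, one_mul, dX_eq]
    module
  · simp [h]

end WarpedFRW

end

noncomputable section

namespace WarpedFRW

/-! ### The Fourier transform on `L¹` and on `L²` -/

section Fourier

open scoped FourierTransform ContDiff

variable {V F : Type*} [NormedAddCommGroup V] [InnerProductSpace ℝ V] [FiniteDimensional ℝ V]
  [MeasurableSpace V] [BorelSpace V]

section Banach

variable [NormedAddCommGroup F] [NormedSpace ℂ F] [CompleteSpace F]

/-! In the coordinates u_μ = log|x^μ| on each of the sixteen orthants, with the square root of the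
Jacobian absorbed, the dilations U(p) are translations, and a Fourier transform makes them
multiplication by e^{i p·x(k)}, x(k)_μ = 2π a^μ k_μ (`spec_U`). The isometry `spec` so obtained
diagonalises all X^μ at once: ξ = f(X)ψ means that `spec ξ` is f(x(k)) times `spec ψ`
(`hasFun_iff`).

The deformation becomes a Gaussian computation. Since P^μ scales under dilations (`P_U`), A =
(dX^μ)² satisfies α_{Θx}(A)U(y)φ = e^{-v·x+w·y} U(y)Aφ with v_ν = 2a^μ Θ_{μν} (no sum) and w = 2a^μ
at the single index μ. Skew-symmetry makes the supports of v and w disjoint, and the regularised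
integral is multiplication by the explicit `warpSymbol`, which tends to e^{-v·x(k)} as the cut-off
is removed. The bound `norm_warpSymbol_le` by a multiple of 1 + e^{-v·x(k)} lets dominated
convergence apply on all of the domain of e^{-v·X}; conversely an L² limit must agree with the
pointwise one (`hasWarpedConv_iff`). Hence domains match exactly and g_{μμ} = η_{μμ} e^{-2a^μ
Θ_{μλ}x^λ}; the constraints on Θ turn this into the stated metric (`deformedMetric_eq`).

When only a^0 varies, g_00 in the spectral representation is e^{-r_k L} with L fixed and r_k → 0.
For r between 0 and some r_0 this is at most 1 + e^{-r_0 L}, so domination comes from a single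
vector in the domain (`tendsto_of_exp_smul`). The two line-elements differ only in the time-time
term, and (dX^0)² is (a_0)² times a fixed operator, so their rescaled difference is governed by the
strong convergence of g_00(X_k).

For density, the functions x^β e^{-(log|x|)²/2} on the half-lines are Schwartz and their products
have Gaussian spectral images. A real exponential of the X^μ only shifts β and multiplies by a
constant (`exists_spec_eq_exp_smul`). Derivatives add a polynomial factor, but only in the
coordinate absent from the exponent. Injectivity of the Fourier transform on L¹ shows that the span
is dense (`eq_zero_of_inner_logGaussProd`). -/

theorem integral_schwartz_smul_fourier {f : V → F} (hf : Integrable f) (g : 𝓢(V, ℂ)) :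
    ∫ x, g x • 𝓕 f x = ∫ x, 𝓕 (g : V → ℂ) x • f x := by
  have h := VectorFourier.integral_fourierIntegral_smul_eq_flip (e := Real.fourierChar)
    (μ := volume) (ν := volume) (L := innerₗ V) (f := (g : V → ℂ)) (g := f)
    Real.continuous_fourierChar continuous_inner g.integrable hf
  rw [flip_innerₗ] at h
  exact h.symm

/-- The Fourier transform is injective on `L¹`. -/
theorem ae_eq_zero_of_fourier_eq_zero {f : V → F} (hf : Integrable f) (h : ∀ x, 𝓕 f x = 0) :
    f =ᵐ[volume] 0 := by
  refine ae_eq_zero_of_integral_contDiff_smul_eq_zero hf.locallyIntegrable fun g hg hc => ?_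
  have hc' : HasCompactSupport (Complex.ofRealCLM ∘ g) := hc.comp_left rfl
  have hg' : ContDiff ℝ ∞ (Complex.ofRealCLM ∘ g) := by fun_prop
  set G : 𝓢(V, ℂ) := hc'.toSchwartzMap hg'
  -- Pairing with the inverse transform of the test function leaves the test function itself on the
  -- side of f.
  have key := integral_schwartz_smul_fourier hf (𝓕⁻ G)
  rw [← SchwartzMap.fourier_coe, FourierTransform.fourier_fourierInv_eq] at key
  simp only [h, smul_zero, integral_zero] at key
  rw [key]
  refine integral_congr_ae (.of_forall fun x => ?_)
  simp [G]

end Banach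

variable [NormedAddCommGroup F] [InnerProductSpace ℂ F] [CompleteSpace F]

/-- The L² transform is compatible with that of tempered distributions, where this duality is the
definition. -/
theorem integral_schwartz_smul_fourier_Lp (f : Lp F 2 (volume : Measure V)) (g : 𝓢(V, ℂ)) :
    ∫ x, g x • (𝓕 f : Lp F 2 (volume : Measure V)) x = ∫ x, 𝓕 (g : V → ℂ) x • f x := by
  have h := DFunLike.congr_fun (Lp.fourier_toTemperedDistribution_eq f) g
  rw [TemperedDistribution.fourier_apply, Lp.toTemperedDistribution_apply,
    Lp.toTemperedDistribution_apply] at h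
  exact h.symm

/-- On `L¹ ∩ L²` the Fourier transform is given by the Fourier integral. -/
theorem coeFn_fourier_toLp {f : V → F} (hf : Integrable f) (hf2 : MemLp f 2) :
    (𝓕 (hf2.toLp f) : Lp F 2 (volume : Measure V)) =ᵐ[volume] 𝓕 f := by
  have hcont : Continuous (𝓕 f) := VectorFourier.fourierIntegral_continuous
    Real.continuous_fourierChar continuous_inner hf
  refine ae_eq_of_integral_contDiff_smul_eq ((Lp.memLp _).locallyIntegrable one_le_two)
    hcont.locallyIntegrable fun g hg hc => ?_
  have hc' : HasCompactSupport (Complex.ofRealCLM ∘ g) := hc.comp_left rfl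
  have hg' : ContDiff ℝ ∞ (Complex.ofRealCLM ∘ g) := by fun_prop
  set G : 𝓢(V, ℂ) := hc'.toSchwartzMap hg'
  have e (x : V) (y : F) : g x • y = G x • y := by simp [G]
  simp only [e]
  rw [integral_schwartz_smul_fourier_Lp, integral_schwartz_smul_fourier hf]
  refine integral_congr_ae ?_
  filter_upwards [hf2.coeFn_toLp] with x hx
  rw [hx]

/-- The Fourier transform turns translations into modulations. -/
theorem coeFn_fourier_of_translate {f h : Lp F 2 (volume : Measure V)} {c : V}
    (hfh : ∀ᵐ x, h x = f (x + c)) :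
    (𝓕 h : Lp F 2 (volume : Measure V)) =ᵐ[volume]
      fun x => Complex.exp (2 * Real.pi * Complex.I * (inner ℝ c x : ℝ)) •
        (𝓕 f : Lp F 2 (volume : Measure V)) x := by
  have hexp : ContDiff ℝ ∞ fun x : V =>
      Complex.exp (2 * Real.pi * Complex.I * (inner ℝ c x : ℝ)) := by
    have : ContDiff ℝ ∞ fun x : V => ((inner ℝ c x : ℝ) : ℂ) :=
      Complex.ofRealCLM.contDiff.comp (contDiff_const.inner ℝ contDiff_id)
    exact (contDiff_const.mul this).cexp
  refine ae_eq_of_integral_contDiff_smul_eq ((Lp.memLp _).locallyIntegrable one_le_two) ?_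
    fun g hg hc => ?_
  · exact ((Lp.memLp (𝓕 f : Lp F 2 (volume : Measure V))).locallyIntegrable
      one_le_two).continuous_smul hexp.continuous
  have hc' : HasCompactSupport (Complex.ofRealCLM ∘ g) := hc.comp_left rfl
  have hg' : ContDiff ℝ ∞ (Complex.ofRealCLM ∘ g) := by fun_prop
  set G : 𝓢(V, ℂ) := hc'.toSchwartzMap hg'
  -- Modulating the test function translates its Fourier transform, which absorbs the translation by
  -- c.
  set E : 𝓢(V, ℂ) := (hc'.mul_left (f := fun x : V =>
    Complex.exp (2 * Real.pi * Complex.I * (inner ℝ c x : ℝ)))).toSchwartzMap (hexp.mul hg')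
  have hEG (x : V) : E x = Complex.exp (2 * Real.pi * Complex.I * (inner ℝ c x : ℝ)) * G x := rfl
  have hE (x : V) : 𝓕 (E : V → ℂ) (x + c) = 𝓕 (G : V → ℂ) x := by
    rw [Real.fourier_eq', Real.fourier_eq']
    refine integral_congr_ae (.of_forall fun y => ?_)
    simp only [hEG, inner_add_right, smul_eq_mul]
    rw [← mul_assoc, ← Complex.exp_add, real_inner_comm y c]
    congr 2
    push_cast
    ring
  calc ∫ x, g x • (𝓕 h : Lp F 2 (volume : Measure V)) x
      = ∫ x, G x • (𝓕 h : Lp F 2 (volume : Measure V)) x := by simp [G]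
    _ = ∫ x, 𝓕 (G : V → ℂ) x • h x := integral_schwartz_smul_fourier_Lp h G
    _ = ∫ x, 𝓕 (E : V → ℂ) (x + c) • f (x + c) := by
      refine integral_congr_ae ?_
      filter_upwards [hfh] with x hx
      rw [hx, hE]
    _ = ∫ x, 𝓕 (E : V → ℂ) x • f x :=
      integral_add_right_eq_self (fun x => 𝓕 (E : V → ℂ) x • f x) c
    _ = ∫ x, E x • (𝓕 f : Lp F 2 (volume : Measure V)) x :=
      (integral_schwartz_smul_fourier_Lp f E).symm
    _ = _ := by
      refine integral_congr_ae (.of_forall fun x => ?_)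
      simp only [hEG, mul_comm _ (G x), mul_smul]
      simp [G]

end Fourier

/-! ### Logarithmic coordinates on the orthants -/

/-- A copy of `R4` with the Euclidean inner product. -/
abbrev E4 : Type := EuclideanSpace ℝ (Fin 4)

/-- The orthants of `ℝ⁴`. -/
abbrev Orthant : Type := Fin 4 → ℤˣ

/-- One complex component for each orthant. -/
abbrev Fiber : Type := EuclideanSpace ℂ Orthant

/-- The chart `u ↦ (± e^{u_μ})_μ` of an orthant. -/
def logChart (s : Orthant) (u : R4) : R4 := fun μ => ((s μ : ℤ) : ℝ) * Real.exp (u μ)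

theorem sign_mul_self (e : ℤˣ) : ((e : ℤ) : ℝ) * ((e : ℤ) : ℝ) = 1 := by
  rcases Int.units_eq_one_or e with h | h <;> simp [h]

theorem sign_ne_zero (e : ℤˣ) : ((e : ℤ) : ℝ) ≠ 0 := fun h => by
  simpa [h] using sign_mul_self e

theorem abs_sign (e : ℤˣ) : |((e : ℤ) : ℝ)| = 1 := by
  rcases Int.units_eq_one_or e with h | h <;> simp [h]

theorem continuous_logChart (s : Orthant) : Continuous (logChart s) := by
  unfold logChart
  fun_prop

theorem logChart_injective (s : Orthant) : Function.Injective (logChart s) := fun u v h => by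
  funext μ
  exact Real.exp_injective (mul_left_cancel₀ (sign_ne_zero (s μ)) (congrFun h μ))

theorem range_logChart (s : Orthant) :
    Set.range (logChart s) = {x | ∀ μ, 0 < ((s μ : ℤ) : ℝ) * x μ} := by
  ext x
  constructor
  · rintro ⟨u, rfl⟩ μ
    simp only [logChart, ← mul_assoc, sign_mul_self, one_mul]
    exact Real.exp_pos _
  · intro h
    refine ⟨fun μ => Real.log (((s μ : ℤ) : ℝ) * x μ), ?_⟩
    funext μ
    simp only [logChart]
    rw [Real.exp_log (h μ), ← mul_assoc, sign_mul_self, one_mul]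

theorem hasFDerivAt_logChart (s : Orthant) (u : R4) :
    HasFDerivAt (logChart s) (ContinuousLinearMap.pi fun μ =>
      (logChart s u μ • ContinuousLinearMap.id ℝ ℝ).comp
        (ContinuousLinearMap.proj (R := ℝ) (φ := fun _ : Fin 4 => ℝ) μ)) u := by
  rw [hasFDerivAt_pi]
  intro μ
  have h := (((ContinuousLinearMap.proj (R := ℝ) (φ := fun _ : Fin 4 => ℝ) μ).hasFDerivAt
    (x := u)).exp).const_mul ((s μ : ℤ) : ℝ)
  refine h.congr_fderiv ?_
  ext v
  simp [logChart, mul_assoc]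

theorem abs_det_logChart (s : Orthant) (u : R4) :
    |(ContinuousLinearMap.pi fun μ => (logChart s u μ • ContinuousLinearMap.id ℝ ℝ).comp
        (ContinuousLinearMap.proj (R := ℝ) (φ := fun _ : Fin 4 => ℝ) μ)).det| =
      Real.exp (∑ μ, u μ) := by
  rw [ContinuousLinearMap.det_pi, Finset.abs_prod, Real.exp_sum]
  refine Finset.prod_congr rfl fun μ _ => ?_
  simp [logChart, abs_mul, abs_sign, ContinuousLinearMap.det]

theorem iUnion_range_logChart_ae : (⋃ s, Set.range (logChart s)) =ᵐ[volume] Set.univ := by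
  rw [eventuallyEq_univ]
  have h (μ : Fin 4) : ∀ᵐ x : R4, x μ ≠ 0 := by
    have : (volume : Measure ℝ) {0} = 0 := by simp
    exact (Measure.quasiMeasurePreserving_eval (fun _ : Fin 4 => (volume : Measure ℝ)) μ).ae
      (measure_eq_zero_iff_ae_notMem.1 this)
  filter_upwards [ae_all_iff.2 h] with x hx
  rw [Set.mem_iUnion]
  have (μ : Fin 4) : ∃ e : ℤˣ, 0 < ((e : ℤ) : ℝ) * x μ := by
    rcases lt_or_gt_of_ne (hx μ) with h | h
    · exact ⟨-1, by simpa using h⟩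
    · exact ⟨1, by simpa using h⟩
  choose s hs using this
  exact ⟨s, by rw [range_logChart]; exact hs⟩

/-- Integration over `ℝ⁴` in logarithmic coordinates. -/
theorem lintegral_eq_sum_logChart (G : R4 → ENNReal) :
    ∫⁻ x, G x = ∑ s, ∫⁻ u, ENNReal.ofReal (Real.exp (∑ μ, u μ)) * G (logChart s u) := by
  have hm (s : Orthant) : MeasurableSet (Set.range (logChart s)) := by
    rw [range_logChart, Set.ofPred_forall]
    exact MeasurableSet.iInter fun μ => measurableSet_lt measurable_const (by fun_prop)
  have hd : Pairwise (Function.onFun Disjoint fun s => Set.range (logChart s)) := by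
    intro s t hst
    refine Set.disjoint_left.2 fun x hs ht => hst ?_
    simp only [range_logChart] at hs ht
    funext μ
    have h1 := hs μ
    have h2 := ht μ
    rcases Int.units_eq_one_or (s μ) with e | e <;> rcases Int.units_eq_one_or (t μ) with e' | e' <;>
      rw [e] at h1 ⊢ <;> rw [e'] at h2 ⊢ <;> simp at h1 h2 <;> linarith
  calc ∫⁻ x, G x = ∫⁻ x in ⋃ s, Set.range (logChart s), G x := by
        rw [setLIntegral_congr iUnion_range_logChart_ae, setLIntegral_univ]
    _ = ∑ s, ∫⁻ x in Set.range (logChart s), G x := by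
        rw [lintegral_iUnion hm hd, tsum_fintype]
    _ = _ := by
        refine Finset.sum_congr rfl fun s _ => ?_
        rw [← Set.image_univ, lintegral_image_eq_lintegral_abs_det_fderiv_mul volume
          MeasurableSet.univ (fun u _ => (hasFDerivAt_logChart s u).hasFDerivWithinAt)
          (logChart_injective s).injOn, setLIntegral_univ]
        simp only [abs_det_logChart]

/-- The change of variables applied to the indicator of a null set has a strictly positive weight,
so the preimage in every chart is null as well. -/
theorem ae_logChart {p : R4 → Prop} (h : ∀ᵐ x, p x) (s : Orthant) :
    ∀ᵐ u : R4, p (logChart s u) := by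
  set N := toMeasurable volume {x | ¬ p x}
  have hN : MeasurableSet N := measurableSet_toMeasurable _ _
  have h0 : ∫⁻ x, N.indicator 1 x = 0 := by
    rw [lintegral_indicator_one hN, measure_toMeasurable]
    exact h
  rw [lintegral_eq_sum_logChart, Finset.sum_eq_zero_iff] at h0
  have h1 := h0 s (Finset.mem_univ s)
  have hmeas : Measurable fun u : R4 =>
      ENNReal.ofReal (Real.exp (∑ μ, u μ)) * N.indicator 1 (logChart s u) := by
    refine Measurable.mul (by fun_prop) ?_
    exact (measurable_one.indicator hN).comp (continuous_logChart s).measurable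
  rw [lintegral_eq_zero_iff hmeas] at h1
  filter_upwards [h1] with u hu
  by_contra hp
  have hmem : logChart s u ∈ N := subset_toMeasurable volume {x | ¬ p x} hp
  simp only [hmem, Set.indicator_of_mem, Pi.one_apply, mul_one, Pi.zero_apply,
    ENNReal.ofReal_eq_zero] at hu
  exact absurd hu (not_le.2 (Real.exp_pos _))

/-! ### The Mellin isometry and the spectral representation -/

/-- `φ` in logarithmic coordinates, with the square root of the Jacobian as a factor. -/
def mellinFun (f : R4 → ℂ) (u : E4) : Fiber :=
  WithLp.toLp 2 fun s => (Real.exp ((∑ μ, u μ) / 2) : ℂ) * f (logChart s u)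

theorem mellinFun_congr {f g : R4 → ℂ} (h : f =ᵐ[volume] g) :
    mellinFun f =ᵐ[volume] mellinFun g := by
  have h1 : ∀ᵐ u : R4, ∀ s, f (logChart s u) = g (logChart s u) :=
    ae_all_iff.2 fun s => ae_logChart h s
  filter_upwards [(PiLp.volume_preserving_ofLp (Fin 4)).quasiMeasurePreserving.ae h1] with u hu
  simp [mellinFun, hu]

theorem measurable_mellinFun {f : R4 → ℂ} (hf : Measurable f) : Measurable (mellinFun f) := by
  have h (s : Orthant) : Measurable fun u : E4 =>
      (Real.exp ((∑ μ, u μ) / 2) : ℂ) * f (logChart s u) := by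
    refine Measurable.mul (by fun_prop) (hf.comp ((continuous_logChart s).measurable.comp ?_))
    exact (PiLp.volume_preserving_ofLp (Fin 4)).measurable
  exact (WithLp.measurable_toLp 2 _).comp (measurable_pi_iff.2 h)

theorem enorm_sq_fiber (v : Fiber) : ‖v‖ₑ ^ 2 = ∑ s, ‖v s‖ₑ ^ 2 := by
  simp only [← ofReal_norm, ← ENNReal.ofReal_pow (norm_nonneg _)]
  rw [EuclideanSpace.norm_sq_eq, ENNReal.ofReal_sum_of_nonneg fun _ _ => by positivity]

/-- The prefactor e^{Σu/2} squares to the Jacobian, which has the same absolute value e^{Σu} on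
every orthant. -/
theorem lintegral_mellinFun {f : R4 → ℂ} (hf : Measurable f) :
    ∫⁻ u, ‖mellinFun f u‖ₑ ^ 2 = ∫⁻ x, ‖f x‖ₑ ^ 2 := by
  rw [lintegral_eq_sum_logChart]
  have h0 (u : E4) : ‖mellinFun f u‖ₑ ^ 2 =
      ∑ s, ENNReal.ofReal (Real.exp (∑ μ, u μ)) * ‖f (logChart s u)‖ₑ ^ 2 := by
    rw [enorm_sq_fiber]
    refine Finset.sum_congr rfl fun s _ => ?_
    simp only [mellinFun, enorm_mul, mul_pow]
    congr 1
    rw [← ofReal_norm, ← ENNReal.ofReal_pow (norm_nonneg _), Complex.norm_real, Real.norm_eq_abs,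
      abs_of_pos (Real.exp_pos _), ← Real.exp_nat_mul]
    congr 2
    push_cast
    ring
  have hm (s : Orthant) : Measurable fun u : R4 =>
      ENNReal.ofReal (Real.exp (∑ μ, u μ)) * ‖f (logChart s u)‖ₑ ^ 2 :=
    Measurable.mul (by fun_prop) ((hf.comp (continuous_logChart s).measurable).enorm.pow_const 2)
  rw [← lintegral_finsetSum _ fun s _ => hm s,
    ← (PiLp.volume_preserving_ofLp (Fin 4)).lintegral_comp (Finset.measurable_sum _ fun s _ => hm s)]
  simp only [h0]

theorem eLpNorm_two_eq {α G : Type*} [MeasurableSpace α] [NormedAddCommGroup G] (μ : Measure α)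
    (f : α → G) : eLpNorm f 2 μ = (∫⁻ x, ‖f x‖ₑ ^ 2 ∂μ) ^ (1 / 2 : ℝ) := by
  rw [eLpNorm_eq_lintegral_rpow_enorm_toReal two_ne_zero ENNReal.ofNat_ne_top]
  simp

theorem eLpNorm_mellinFun {f : R4 → ℂ} (hf : Measurable f) :
    eLpNorm (mellinFun f) 2 volume = eLpNorm f 2 volume := by
  rw [eLpNorm_two_eq, eLpNorm_two_eq, lintegral_mellinFun hf]

theorem memLp_mellinFun (f : Hilb) : MemLp (mellinFun f) 2 volume :=
  ⟨(measurable_mellinFun (Lp.stronglyMeasurable f).measurable).aestronglyMeasurable, by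
    rw [eLpNorm_mellinFun (Lp.stronglyMeasurable f).measurable]
    exact Lp.eLpNorm_lt_top f⟩

/-- The `L²` space on which the dilations act as multiplication operators. -/
abbrev Spec : Type := Lp Fiber 2 (volume : Measure E4)

/-- The isometry from `L²(ℝ⁴)` given by logarithmic coordinates on all orthants. -/
def mellin : Hilb →ₗᵢ[ℂ] Spec where
  toFun f := (memLp_mellinFun f).toLp _
  map_add' f g := by
    rw [← MemLp.toLp_add, MemLp.toLp_eq_toLp_iff]
    filter_upwards [mellinFun_congr (Lp.coeFn_add f g)] with u hu
    rw [hu]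
    ext s
    simp [mellinFun, mul_add]
  map_smul' c f := by
    rw [RingHom.id_apply, ← MemLp.toLp_const_smul, MemLp.toLp_eq_toLp_iff]
    filter_upwards [mellinFun_congr (Lp.coeFn_smul c f)] with u hu
    rw [hu]
    ext s
    simp [mellinFun, mul_left_comm]
  norm_map' f := by
    change ‖(memLp_mellinFun f).toLp _‖ = ‖f‖
    rw [Lp.norm_toLp, eLpNorm_mellinFun (Lp.stronglyMeasurable f).measurable, Lp.norm_def]

theorem coeFn_mellin {f : Hilb} {g : R4 → ℂ} (h : f =ᵐ[volume] g) :
    mellin f =ᵐ[volume] mellinFun g :=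
  (memLp_mellinFun f).coeFn_toLp.trans (mellinFun_congr h)

theorem coeFn_incl (φ : Dom) : incl φ =ᵐ[volume] φ := SchwartzMap.coeFn_toLp φ 2 volume

open scoped FourierTransform in
/-- The isometry of `L²(ℝ⁴)` onto its spectral representation. -/
def spec : Hilb →ₗᵢ[ℂ] Spec :=
  (Lp.fourierTransformₗᵢ E4 Fiber).toLinearIsometry.comp mellin

/-- The joint spectral values of `X⁰, …, X³` in the spectral representation. -/
def spectralPoint (a : R4) (k : E4) : R4 := fun μ => 2 * Real.pi * a μ * k μ

/-- Scaling x^μ by e^{a^μ p_μ} shifts u_μ by a^μ p_μ on every orthant, and the normalising factor of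
U(p) is exactly the change in the square root of the Jacobian. The Fourier transform then turns the
shift into a phase. -/
theorem spec_U (a p : R4) (φ : Dom) : spec (incl (U a p φ)) =ᵐ[volume] fun k =>
    Complex.exp (Complex.I * ((∑ μ, p μ * spectralPoint a k μ : ℝ) : ℂ)) • spec (incl φ) k := by
  set c : E4 := WithLp.toLp 2 fun μ => a μ * p μ
  have h1 : ∀ᵐ u, mellin (incl (U a p φ)) u = mellin (incl φ) (u + c) := by
    have hq : Measure.QuasiMeasurePreserving (fun u : E4 => u + c) volume volume :=
      (measurePreserving_add_right volume c).quasiMeasurePreserving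
    filter_upwards [coeFn_mellin (coeFn_incl (U a p φ)), hq.ae (coeFn_mellin (coeFn_incl φ))]
      with u hu hu'
    rw [hu, hu']
    ext s
    simp only [mellinFun, U_apply, ← mul_assoc]
    congr 1
    · rw [← Complex.ofReal_mul, ← Real.exp_add]
      simp only [PiLp.add_apply, c, Finset.sum_add_distrib, add_div]
    · congr 1
      funext μ
      simp only [logChart, PiLp.add_apply, c, Real.exp_add]
      ring
  filter_upwards [coeFn_fourier_of_translate h1] with k hk
  refine hk.trans ?_
  congr 2
  simp only [c, PiLp.inner_apply, spectralPoint, Complex.ofReal_sum, Finset.mul_sum]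
  refine Finset.sum_congr rfl fun μ _ => ?_
  simp
  ring

/-! ### The spectral calculus in the spectral representation -/

open scoped NNReal ENNReal

@[fun_prop]
theorem continuous_spectralPoint (a : R4) : Continuous (spectralPoint a) := by
  unfold spectralPoint
  fun_prop

/-- The spectral measure of `X⁰, …, X³` in the vector `ψ`. -/
def specMeasure (a : R4) (ψ : Dom) : Measure R4 :=
  ((volume : Measure E4).withDensity fun k =>
    ((‖spec (incl ψ) k‖₊ ^ 2 : ℝ≥0) : ℝ≥0∞)).map (spectralPoint a)

theorem measurable_spec (f : Hilb) : Measurable (spec f) :=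
  (Lp.stronglyMeasurable _).measurable

theorem measurable_nnnorm_sq_spec (f : Hilb) : Measurable fun k => ‖spec f k‖₊ ^ 2 :=
  (measurable_spec f).nnnorm.pow_const 2

theorem integrable_norm_sq_spec (f : Hilb) : Integrable fun k => ‖spec f k‖ ^ 2 :=
  (memLp_two_iff_integrable_sq_norm (Lp.aestronglyMeasurable _)).1 (Lp.memLp _)

theorem integral_norm_sq_spec (f : Hilb) : ∫ k, ‖spec f k‖ ^ 2 = ‖f‖ ^ 2 := by
  have h : (inner ℂ (spec f) (spec f) : ℂ) = (‖spec f‖ : ℂ) ^ 2 := inner_self_eq_norm_sq_to_K _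
  rw [L2.inner_def, spec.norm_map] at h
  have h2 : ∀ k, (inner ℂ (spec f k) (spec f k) : ℂ) = ((‖spec f k‖ ^ 2 : ℝ) : ℂ) := fun k => by
    rw [inner_self_eq_norm_sq_to_K]; norm_cast
  simp only [h2] at h
  rw [integral_complex_ofReal] at h
  exact_mod_cast h

theorem integral_specMeasure {G : Type*} [NormedAddCommGroup G] [NormedSpace ℝ G] (a : R4)
    (ψ : Dom) {f : R4 → G} (hf : StronglyMeasurable f) :
    ∫ x, f x ∂specMeasure a ψ = ∫ k, ‖spec (incl ψ) k‖ ^ 2 • f (spectralPoint a k) := by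
  rw [specMeasure, integral_map (continuous_spectralPoint a).aemeasurable hf.aestronglyMeasurable,
    integral_withDensity_eq_integral_smul (measurable_nnnorm_sq_spec _)]
  rfl

theorem integrable_specMeasure_iff {G : Type*} [NormedAddCommGroup G] [NormedSpace ℝ G] (a : R4)
    (ψ : Dom) {f : R4 → G} (hf : StronglyMeasurable f) :
    Integrable f (specMeasure a ψ) ↔
      Integrable fun k => ‖spec (incl ψ) k‖ ^ 2 • f (spectralPoint a k) := by
  rw [specMeasure, integrable_map_measure hf.aestronglyMeasurable
      (continuous_spectralPoint a).aemeasurable,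
    integrable_withDensity_iff_integrable_smul (measurable_nnnorm_sq_spec _)]
  rfl

instance isFiniteMeasure_specMeasure (a : R4) (ψ : Dom) : IsFiniteMeasure (specMeasure a ψ) := by
  have h : Integrable (fun _ : R4 => (1 : ℝ)) (specMeasure a ψ) := by
    rw [integrable_specMeasure_iff a ψ stronglyMeasurable_const]
    simpa using integrable_norm_sq_spec (incl ψ)
  exact (integrable_const_iff_isFiniteMeasure one_ne_zero).1 h

/-- This reads the pairing condition in `HasFun` as a Fourier transform, in the rescaled variable
a^μ p_μ, of the pointwise inner product of the spectral images. -/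
theorem inner_U_eq_integral (a p : R4) (ψ : Dom) (ξ : Hilb) :
    inner ℂ (incl (U a p ψ)) ξ = ∫ k, Complex.exp (-Complex.I *
      ((∑ μ, p μ * spectralPoint a k μ : ℝ) : ℂ)) * inner ℂ (spec (incl ψ) k) (spec ξ k) := by
  rw [← spec.inner_map_map, L2.inner_def]
  refine integral_congr_ae ?_
  filter_upwards [spec_U a p ψ] with k hk
  rw [hk, inner_smul_left, ← Complex.exp_conj, map_mul, Complex.conj_I, Complex.conj_ofReal]

theorem isSpectralMeasure_specMeasure (a : R4) (ψ : Dom) :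
    IsSpectralMeasure a ψ (specMeasure a ψ) := by
  refine ⟨inferInstance, fun p => ?_⟩
  have hm : StronglyMeasurable fun x : R4 =>
      Complex.exp (Complex.I * ((∑ μ, p μ * x μ : ℝ) : ℂ)) :=
    Continuous.stronglyMeasurable (by fun_prop)
  rw [integral_specMeasure a ψ hm, ← spec.inner_map_map, L2.inner_def]
  refine integral_congr_ae ?_
  filter_upwards [spec_U a p ψ] with k hk
  rw [hk, inner_smul_right, inner_self_eq_norm_sq_to_K, Complex.real_smul, mul_comm]
  norm_cast

/-- A finite measure is determined by its characteristic function, which the definition prescribes.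
The existential measure in `HasFun` can thus be replaced by `specMeasure`. -/
theorem IsSpectralMeasure.unique {a : R4} {ψ : Dom} {m m' : Measure R4}
    (h : IsSpectralMeasure a ψ m) (h' : IsSpectralMeasure a ψ m') : m = m' := by
  have := h.1
  have := h'.1
  refine Measure.ext_of_charFunDual (funext fun L => ?_)
  have key (m : Measure R4) (h : IsSpectralMeasure a ψ m) : charFunDual m L =
      inner ℂ (incl ψ) (incl (U a (fun μ => L (Pi.single μ 1)) ψ)) := by
    rw [h.2, charFunDual_apply]
    refine integral_congr_ae (.of_forall fun x => ?_)
    have : L x = ∑ μ, L (Pi.single μ 1) * x μ := by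
      conv_lhs => rw [pi_eq_sum_univ' x]
      rw [map_sum]
      exact Finset.sum_congr rfl fun μ _ => by rw [map_smul, smul_eq_mul, mul_comm]
    beta_reduce
    rw [← this, mul_comm]
  rw [key m h, key m' h']

/-- In the spectral representation `f(X)` is multiplication by `f`. -/
theorem hasFun_iff {a : R4} (ha : ∀ μ, a μ ≠ 0) {f : R4 → ℝ} (hf : Measurable f) (ψ : Dom)
    (ξ : Hilb) :
    HasFun a f ψ ξ ↔
      spec ξ =ᵐ[volume] fun k => (f (spectralPoint a k) : ℂ) • spec (incl ψ) k := by
  have hsq : StronglyMeasurable fun x => f x ^ 2 := (hf.pow_const 2).stronglyMeasurable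
  have hfC : StronglyMeasurable fun x => (f x : ℂ) :=
    (Complex.measurable_ofReal.comp hf).stronglyMeasurable
  have hexp (p : R4) : Continuous fun x : R4 =>
      Complex.exp (-Complex.I * ((∑ μ, p μ * x μ : ℝ) : ℂ)) := by fun_prop
  have hfp (p : R4) : StronglyMeasurable fun x : R4 =>
      Complex.exp (-Complex.I * ((∑ μ, p μ * x μ : ℝ) : ℂ)) * (f x : ℂ) :=
    (hexp p).stronglyMeasurable.mul hfC
  have hmem : MemLp f 2 (specMeasure a ψ) ↔
      Integrable fun k => ‖spec (incl ψ) k‖ ^ 2 • f (spectralPoint a k) ^ 2 := by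
    rw [memLp_two_iff_integrable_sq hf.aestronglyMeasurable, integrable_specMeasure_iff a ψ hsq]
  constructor
  · rintro ⟨m, hm, hmf, hinner, hnorm⟩
    obtain rfl := hm.unique (isSpectralMeasure_specMeasure a ψ)
    have i1 : Integrable fun k => inner ℂ (spec (incl ψ) k) (spec ξ k) := L2.integrable_inner _ _
    have i2 : Integrable fun k => ‖spec (incl ψ) k‖ ^ 2 • (f (spectralPoint a k) : ℂ) :=
      (integrable_specMeasure_iff a ψ hfC).1 (hmf.integrable one_le_two).ofReal
    have i3 := hmem.1 hmf
    -- Because every a^μ is non-zero, the moments over all p give the whole Fourier transform, so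
    -- the inner products agree for almost every k.
    have hG : (fun k => inner ℂ (spec (incl ψ) k) (spec ξ k) -
        ‖spec (incl ψ) k‖ ^ 2 • (f (spectralPoint a k) : ℂ)) =ᵐ[volume] 0 := by
      refine ae_eq_zero_of_fourier_eq_zero (i1.sub i2) fun x => ?_
      set p : R4 := fun μ => x μ / a μ with hp
      have hph (k : E4) : ∑ μ, p μ * spectralPoint a k μ = 2 * Real.pi * inner ℝ k x := by
        simp only [PiLp.inner_apply, Finset.mul_sum, hp, spectralPoint]
        refine Finset.sum_congr rfl fun μ _ => ?_
        have := ha μ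
        simp
        field_simp
      have h1 := hinner p
      rw [inner_U_eq_integral, integral_specMeasure a ψ (hfp p)] at h1
      have hb : Continuous fun k : E4 => Complex.exp (-Complex.I *
          ((∑ μ, p μ * spectralPoint a k μ : ℝ) : ℂ)) :=
        (hexp p).comp (continuous_spectralPoint a)
      have hbn (k : E4) : ‖Complex.exp (-Complex.I *
          ((∑ μ, p μ * spectralPoint a k μ : ℝ) : ℂ))‖ ≤ 1 := by
        simp [Complex.norm_exp]
      have j1 := i1.bdd_mul hb.aestronglyMeasurable (.of_forall hbn)
      have j2 := i2.bdd_mul hb.aestronglyMeasurable (.of_forall hbn)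
      rw [Real.fourier_eq']
      calc _ = ∫ k, (Complex.exp (-Complex.I * ((∑ μ, p μ * spectralPoint a k μ : ℝ) : ℂ)) *
              inner ℂ (spec (incl ψ) k) (spec ξ k) -
            Complex.exp (-Complex.I * ((∑ μ, p μ * spectralPoint a k μ : ℝ) : ℂ)) *
              ‖spec (incl ψ) k‖ ^ 2 • (f (spectralPoint a k) : ℂ)) := by
            refine integral_congr_ae (.of_forall fun k => ?_)
            simp only [hph, smul_eq_mul, mul_sub]
            have e : (((-2 * Real.pi * inner ℝ k x : ℝ) : ℂ) * Complex.I) =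
                -Complex.I * ((2 * Real.pi * inner ℝ k x : ℝ) : ℂ) := by
              push_cast; ring
            rw [e]
        _ = 0 := by
            rw [integral_sub j1 j2, h1, sub_eq_zero]
            refine integral_congr_ae (.of_forall fun k => ?_)
            simp only [Complex.real_smul]
            ring
    -- Equal inner products say that f·`spec ψ` is the component of `spec ξ` along `spec ψ` at each
    -- k; by Pythagoras the remainder is a difference of squares, whose integral the norm condition
    -- in `HasFun` makes zero.
    have hpt : ∀ᵐ k, ‖spec ξ k - (f (spectralPoint a k) : ℂ) • spec (incl ψ) k‖ ^ 2 =
        ‖spec ξ k‖ ^ 2 - ‖spec (incl ψ) k‖ ^ 2 • f (spectralPoint a k) ^ 2 := by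
      filter_upwards [hG] with k hk
      rw [Pi.zero_apply, sub_eq_zero] at hk
      have hre : RCLike.re (inner ℂ (spec ξ k) ((f (spectralPoint a k) : ℂ) • spec (incl ψ) k)) =
          ‖spec (incl ψ) k‖ ^ 2 * f (spectralPoint a k) ^ 2 := by
        rw [inner_smul_right, ← inner_conj_symm, hk, Complex.real_smul, ← Complex.ofReal_mul,
          Complex.conj_ofReal, ← Complex.ofReal_mul, RCLike.re_eq_complex_re, Complex.ofReal_re]
        ring
      rw [norm_sub_sq (𝕜 := ℂ), hre, norm_smul, Complex.norm_real, mul_pow, Real.norm_eq_abs,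
        sq_abs, smul_eq_mul]
      ring
    have hint : ∫ k, ‖spec ξ k - (f (spectralPoint a k) : ℂ) • spec (incl ψ) k‖ ^ 2 = 0 := by
      rw [integral_congr_ae hpt, integral_sub (integrable_norm_sq_spec ξ) i3,
        integral_norm_sq_spec, hnorm, integral_specMeasure a ψ hsq, sub_self]
    have hint2 : Integrable fun k =>
        ‖spec ξ k - (f (spectralPoint a k) : ℂ) • spec (incl ψ) k‖ ^ 2 :=
      ((integrable_norm_sq_spec ξ).sub i3).congr (hpt.mono fun k hk => hk.symm)
    rw [integral_eq_zero_iff_of_nonneg (fun _ => by positivity) hint2] at hint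
    filter_upwards [hint] with k hk
    rwa [Pi.zero_apply, sq_eq_zero_iff, norm_eq_zero, sub_eq_zero] at hk
  · intro h
    have hsqn : ∀ᵐ k, ‖spec ξ k‖ ^ 2 =
        ‖spec (incl ψ) k‖ ^ 2 • f (spectralPoint a k) ^ 2 := by
      filter_upwards [h] with k hk
      rw [hk, norm_smul, Complex.norm_real, mul_pow, Real.norm_eq_abs, sq_abs, smul_eq_mul,
        mul_comm]
    refine ⟨specMeasure a ψ, isSpectralMeasure_specMeasure a ψ, ?_, fun p => ?_, ?_⟩
    · exact hmem.2 ((integrable_norm_sq_spec ξ).congr hsqn)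
    · rw [inner_U_eq_integral, integral_specMeasure a ψ (hfp p)]
      refine integral_congr_ae ?_
      filter_upwards [h] with k hk
      rw [hk, inner_smul_right, inner_self_eq_norm_sq_to_K, Complex.real_smul]
      simp only [Complex.coe_algebraMap, Complex.ofReal_pow]
      ring
    · rw [integral_specMeasure a ψ hsq, ← integral_norm_sq_spec, integral_congr_ae hsqn]

/-! ### Warped convolutions in the spectral representation -/

open scoped NNReal ENNReal

/-- Dominated convergence in `L²`. -/
theorem tendsto_Lp_two_of_dominated {α G ι : Type*} [MeasurableSpace α] [NormedAddCommGroup G]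
    {μ : Measure α} {l : Filter ι} [l.IsCountablyGenerated] {F : ι → Lp G 2 μ} {F' : ι → α → G}
    {f : Lp G 2 μ} {bound : α → ℝ} (hb : MemLp bound 2 μ) (hFF' : ∀ᶠ i in l, F i =ᵐ[μ] F' i)
    (hF : ∀ᶠ i in l, ∀ᵐ x ∂μ, ‖F' i x‖ ≤ bound x)
    (hf : ∀ᵐ x ∂μ, ‖f x‖ ≤ bound x) (hlim : ∀ᵐ x ∂μ, Tendsto (fun i => F' i x) l (𝓝 (f x))) :
    Tendsto F l (𝓝 f) := by
  rw [Lp.tendsto_Lp_iff_tendsto_eLpNorm']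
  simp only [eLpNorm_two_eq]
  have hz : (0 : ℝ≥0∞) = (∫⁻ _, (0 : ℝ≥0∞) ∂μ) ^ (1 / 2 : ℝ) := by simp
  rw [hz]
  refine Tendsto.ennrpow_const _ ?_
  have hfin : ∫⁻ x, (2 * ‖bound x‖ₑ) ^ 2 ∂μ ≠ ∞ := by
    simp only [mul_pow]
    rw [lintegral_const_mul' _ _ (by simp)]
    refine ENNReal.mul_ne_top (by simp) ?_
    have := lintegral_rpow_enorm_lt_top_of_eLpNorm_lt_top two_ne_zero ENNReal.ofNat_ne_top hb.2
    simpa using this.ne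
  refine Tendsto.congr' (f₁ := fun i => ∫⁻ x, ‖F' i x - f x‖ₑ ^ 2 ∂μ) ?_ ?_
  · filter_upwards [hFF'] with i hi
    refine lintegral_congr_ae ?_
    filter_upwards [hi] with x hx
    rw [Pi.sub_apply, hx]
  refine tendsto_lintegral_filter_of_dominated_convergence' (fun x => (2 * ‖bound x‖ₑ) ^ 2)
    (hFF'.mono fun i hi => ((((Lp.aestronglyMeasurable (F i)).congr hi).sub
      (Lp.aestronglyMeasurable f)).enorm.pow_const 2)) ?_ hfin ?_
  · filter_upwards [hF] with i hi
    filter_upwards [hi, hf] with x h1 h2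
    have h3 : ‖F' i x - f x‖ₑ ≤ ‖F' i x‖ₑ + ‖f x‖ₑ := enorm_sub_le
    have h4 {y : G} (hy : ‖y‖ ≤ bound x) : ‖y‖ₑ ≤ ‖bound x‖ₑ :=
      enorm_le_iff_norm_le.2 (hy.trans (le_abs_self _))
    have h5 : ‖F' i x - f x‖ₑ ≤ 2 * ‖bound x‖ₑ := by
      rw [two_mul]
      exact h3.trans (add_le_add (h4 h1) (h4 h2))
    gcongr
  · filter_upwards [hlim] with x hx
    have h1 : Tendsto (fun i => F' i x - f x) l (𝓝 0) := by
      simpa using hx.sub_const (f x)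
    have h2 := (ENNReal.continuous_pow 2).tendsto _ |>.comp
      ((continuous_enorm.tendsto (0 : G)).comp h1)
    simpa [Function.comp_def] using h2

theorem norm_incl_U (a p : R4) (ψ : Dom) : ‖incl (U a p ψ)‖ = ‖incl ψ‖ := by
  rw [← spec.norm_map, ← spec.norm_map (incl ψ)]
  refine le_antisymm (Lp.norm_le_norm_of_ae_le ?_) (Lp.norm_le_norm_of_ae_le ?_) <;>
  · filter_upwards [spec_U a p ψ] with k hk
    rw [hk, norm_smul, mul_comm Complex.I, Complex.norm_exp_ofReal_mul_I, one_mul]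

/-- Strong continuity of U supplies the measurability needed for the Hilbert-space valued integrals.
-/
theorem continuous_incl_U (a : R4) (ψ : Dom) : Continuous fun p => incl (U a p ψ) := by
  rw [spec.isometry.isUniformInducing.isInducing.continuous_iff, continuous_iff_continuousAt]
  intro p₀
  refine tendsto_Lp_two_of_dominated (Lp.memLp (spec (incl ψ))).norm (.of_forall (spec_U a · ψ))
    (.of_forall fun p => .of_forall fun k => ?_) ?_ ?_
  · rw [norm_smul, mul_comm Complex.I, Complex.norm_exp_ofReal_mul_I, one_mul]
  · filter_upwards [spec_U a p₀ ψ] with k hk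
    rw [Function.comp_apply, hk, norm_smul, mul_comm Complex.I, Complex.norm_exp_ofReal_mul_I,
      one_mul]
  · filter_upwards [spec_U a p₀ ψ] with k hk
    rw [Function.comp_apply, hk]
    exact Continuous.tendsto (by fun_prop) p₀

/-! ### The regularised oscillatory integral -/

/-- The Gaussian cut-off, the phase and the real exponential factors in a warped convolution. -/
def warpKernel (σ τ : ℝ) (v w : R4) (z : R4 × R4) : ℂ :=
  Complex.exp (-σ * ∑ μ, (z.1 μ : ℂ) ^ 2 - τ * ∑ μ, (z.2 μ : ℂ) ^ 2
    - Complex.I * ∑ μ, (z.1 μ : ℂ) * z.2 μ - ∑ μ, (v μ : ℂ) * z.1 μ + ∑ μ, (w μ : ℂ) * z.2 μ)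

/-- The Gaussian integral of `warpKernel` against a plane wave. -/
def warpSymbol (σ τ : ℝ) (v w : R4) (x : R4) : ℂ :=
  ((4 * σ * τ + 1 : ℂ) ^ 2)⁻¹ * Complex.exp ((τ * ∑ μ, (v μ : ℂ) ^ 2 - ∑ μ, (v μ : ℂ) * x μ
    + σ * ∑ μ, ((w μ : ℂ) + Complex.I * x μ) ^ 2) / (4 * σ * τ + 1))

theorem continuous_warpKernel (σ τ : ℝ) (v w : R4) : Continuous (warpKernel σ τ v w) := by
  unfold warpKernel
  fun_prop

theorem integrable_warpKernel {σ τ : ℝ} (hσ : 0 < σ) (hτ : 0 < τ) (v w : R4) :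
    Integrable (warpKernel σ τ v w) := by
  have h1 := GaussianFourier.integrable_cexp_neg_mul_sum_add (b := (σ : ℂ)) (by simpa using hσ)
    (fun μ => -(v μ : ℂ))
  have h2 := GaussianFourier.integrable_cexp_neg_mul_sum_add (b := (τ : ℂ)) (by simpa using hτ)
    (fun μ => (w μ : ℂ))
  refine (h1.mul_prod h2).mono (continuous_warpKernel σ τ v w).aestronglyMeasurable
    (.of_forall fun z => le_of_eq ?_)
  rw [← Complex.exp_add, warpKernel, Complex.norm_exp, Complex.norm_exp]
  congr 1
  have h3 : (Complex.I * ∑ μ, (z.1 μ : ℂ) * z.2 μ).re = 0 := by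
    have : (Complex.I * ∑ μ, (z.1 μ : ℂ) * z.2 μ) =
        Complex.I * ((∑ μ, z.1 μ * z.2 μ : ℝ) : ℂ) := by push_cast; rfl
    rw [this, Complex.I_mul_re, Complex.ofReal_im, neg_zero]
  rw [Complex.add_re, Complex.sub_re, Complex.sub_re, h3, sub_zero, ← Complex.sub_re,
    ← Complex.add_re]
  congr 1
  simp only [neg_mul, Finset.sum_neg_distrib]
  ring

/-- Both integrations are Gaussian: the x-integral at fixed y first, then the y-integral with the
modified width. -/
theorem integral_warpKernel {σ τ : ℝ} (hσ : 0 < σ) (hτ : 0 < τ) {v w : R4}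
    (hvw : ∀ μ, v μ * w μ = 0) (x : R4) :
    ∫ z, warpKernel σ τ v w z * Complex.exp (Complex.I * ((∑ μ, z.2 μ * x μ : ℝ) : ℂ)) =
      (2 * Real.pi) ^ 4 * warpSymbol σ τ v w x := by
  have hint : Integrable fun z : R4 × R4 => warpKernel σ τ v w z *
      Complex.exp (Complex.I * ((∑ μ, z.2 μ * x μ : ℝ) : ℂ)) := by
    refine (integrable_warpKernel hσ hτ v w).mul_bdd (c := 1)
      (Continuous.aestronglyMeasurable (by fun_prop)) (.of_forall fun z => ?_)
    rw [mul_comm Complex.I, Complex.norm_exp_ofReal_mul_I]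
  have hσ0 : (σ : ℂ) ≠ 0 := by exact_mod_cast hσ.ne'
  have hD : (4 * σ * τ + 1 : ℂ) ≠ 0 := by
    have : (4 * σ * τ + 1 : ℝ) ≠ 0 := by positivity
    exact_mod_cast this
  have hcard : ((Fintype.card (Fin 4) : ℂ) / 2) = (2 : ℕ) := by norm_num
  -- Completing the square in x contributes -|y|²/(4σ), which adds to the cut-off -τ|y|².
  set b : ℂ := τ + 1 / (4 * σ) with hb
  have hbD : b = (4 * σ * τ + 1) / (4 * σ) := by rw [hb]; field_simp
  have hbre : 0 < b.re := by
    have : b = ((τ + 1 / (4 * σ) : ℝ) : ℂ) := by rw [hb]; push_cast; rfl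
    rw [this, Complex.ofReal_re]
    positivity
  have hvw' (μ : Fin 4) : (v μ : ℂ) * w μ = 0 := by exact_mod_cast hvw μ
  have inner_eq (y : R4) : ∫ u : R4, warpKernel σ τ v w (u, y) *
      Complex.exp (Complex.I * ((∑ μ, y μ * x μ : ℝ) : ℂ)) =
      (Real.pi / σ) ^ 2 * Complex.exp ((∑ μ, (v μ : ℂ) ^ 2) / (4 * σ)) *
        Complex.exp (-b * ∑ μ, (y μ : ℂ) ^ 2 +
          ∑ μ, (w μ + Complex.I * x μ + Complex.I * v μ / (2 * σ)) * y μ) := by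
    have e (u : R4) : warpKernel σ τ v w (u, y) *
        Complex.exp (Complex.I * ((∑ μ, y μ * x μ : ℝ) : ℂ)) =
        Complex.exp (-σ * ∑ μ, (u μ : ℂ) ^ 2 + ∑ μ, (-Complex.I * y μ - v μ) * u μ) *
        Complex.exp (-τ * ∑ μ, (y μ : ℂ) ^ 2 + ∑ μ, (w μ + Complex.I * x μ) * y μ) := by
      rw [warpKernel, ← Complex.exp_add, ← Complex.exp_add]
      congr 1
      push_cast
      simp only [Fin.sum_univ_four]
      ring
    simp only [e]
    rw [integral_mul_const, GaussianFourier.integral_cexp_neg_mul_sum_add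
      (by simpa using hσ), hcard, Complex.cpow_natCast, mul_assoc, mul_assoc, ← Complex.exp_add,
      ← Complex.exp_add]
    congr 2
    rw [hb]
    simp only [Fin.sum_univ_four]
    field_simp
    ring_nf
    simp only [Complex.I_sq]
    ring
  rw [Measure.volume_eq_prod, integral_prod_symm _ (by rwa [← Measure.volume_eq_prod])]
  simp only [inner_eq]
  rw [integral_const_mul, GaussianFourier.integral_cexp_neg_mul_sum_add hbre, hcard,
    Complex.cpow_natCast, warpSymbol]
  have hpow : (Real.pi / σ : ℂ) ^ 2 * (Real.pi / b) ^ 2 =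
      (2 * Real.pi) ^ 4 * ((4 * σ * τ + 1 : ℂ) ^ 2)⁻¹ := by
    rw [hbD]
    field_simp
    norm_num
  have hexp : (∑ μ, (v μ : ℂ) ^ 2) / (4 * σ) +
      (∑ μ, (w μ + Complex.I * x μ + Complex.I * v μ / (2 * σ)) ^ 2) / (4 * b) =
      (τ * ∑ μ, (v μ : ℂ) ^ 2 - ∑ μ, (v μ : ℂ) * x μ
        + σ * ∑ μ, ((w μ : ℂ) + Complex.I * x μ) ^ 2) / (4 * σ * τ + 1) := by
    -- The disjointness of the supports of v and w removes the mixed term v_μ w_μ here.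
    have hterm (μ : Fin 4) : (v μ : ℂ) ^ 2 / (4 * σ) +
        (w μ + Complex.I * x μ + Complex.I * v μ / (2 * σ)) ^ 2 / (4 * b) =
        (τ * (v μ : ℂ) ^ 2 - (v μ : ℂ) * x μ + σ * ((w μ : ℂ) + Complex.I * x μ) ^ 2) /
          (4 * σ * τ + 1) := by
      rw [hbD]
      field_simp
      linear_combination (16 * σ * v μ * x μ + 4 * v μ ^ 2) * Complex.I_sq +
        16 * σ * Complex.I * hvw' μ
    rw [Finset.sum_div, Finset.sum_div, ← Finset.sum_add_distrib, Finset.sum_congr rfl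
      fun μ _ => hterm μ, ← Finset.sum_div, Finset.sum_add_distrib, Finset.sum_sub_distrib,
      Finset.mul_sum, Finset.mul_sum]
  rw [← hexp, Complex.exp_add]
  linear_combination (Complex.exp ((∑ μ, (v μ : ℂ) ^ 2) / (4 * σ)) * Complex.exp
    ((∑ μ, (w μ + Complex.I * x μ + Complex.I * v μ / (2 * σ)) ^ 2) / (4 * b))) * hpow

theorem integrable_warpKernel_smul {σ τ : ℝ} (hσ : 0 < σ) (hτ : 0 < τ) (a v w : R4) (ψ : Dom) :
    Integrable fun z => warpKernel σ τ v w z • incl (U a z.2 ψ) := by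
  refine ((integrable_warpKernel hσ hτ v w).norm.mul_const ‖incl ψ‖).mono'
    ((continuous_warpKernel σ τ v w).smul
      ((continuous_incl_U a ψ).comp continuous_snd)).aestronglyMeasurable
    (.of_forall fun z => ?_)
  rw [norm_smul, norm_incl_U]

@[fun_prop]
theorem continuous_warpSymbol (σ τ : ℝ) (v w : R4) : Continuous (warpSymbol σ τ v w) := by
  unfold warpSymbol
  fun_prop

/-- Test against an arbitrary vector and exchange the integrals: at fixed k, U(y) is only a phase,
and the scalar Gaussian integral remains. -/
theorem spec_integral_warpKernel {σ τ : ℝ} (hσ : 0 < σ) (hτ : 0 < τ) {v w : R4}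
    (hvw : ∀ μ, v μ * w μ = 0) (a : R4) (ψ : Dom) :
    spec (∫ z, warpKernel σ τ v w z • incl (U a z.2 ψ)) =ᵐ[volume] fun k =>
      ((2 * Real.pi) ^ 4 * warpSymbol σ τ v w (spectralPoint a k)) • spec (incl ψ) k := by
  set S : E4 → ℂ := fun k => (2 * Real.pi) ^ 4 * warpSymbol σ τ v w (spectralPoint a k) with hS
  have hSc : Continuous S := by fun_prop
  -- The L¹ norm of the kernel bounds the multiplier uniformly in k, so the candidate image lies in
  -- L².
  have hSb (k : E4) : ‖S k‖ ≤ ∫ z, ‖warpKernel σ τ v w z‖ := by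
    simp only [hS]
    rw [← integral_warpKernel hσ hτ hvw]
    refine (norm_integral_le_integral_norm _).trans_eq (integral_congr_ae (.of_forall fun z => ?_))
    simp only [norm_mul]
    rw [mul_comm Complex.I, Complex.norm_exp_ofReal_mul_I, mul_one]
  have hmem : MemLp (fun k => S k • spec (incl ψ) k) 2 volume := by
    refine (Lp.memLp (spec (incl ψ))).of_le_mul (c := ∫ z, ‖warpKernel σ τ v w z‖)
      (hSc.aestronglyMeasurable.smul (Lp.aestronglyMeasurable _)) (.of_forall fun k => ?_)
    rw [norm_smul]
    gcongr
    exact hSb k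
  suffices h : spec (∫ z, warpKernel σ τ v w z • incl (U a z.2 ψ)) = hmem.toLp _ by
    rw [h]
    exact hmem.coeFn_toLp
  refine ext_inner_left ℂ fun ζ => ?_
  have hint := integrable_warpKernel_smul hσ hτ a v w ψ
  have e1 : spec (∫ z, warpKernel σ τ v w z • incl (U a z.2 ψ)) =
      ∫ z, spec (warpKernel σ τ v w z • incl (U a z.2 ψ)) :=
    (spec.toContinuousLinearMap.integral_comp_comm hint).symm
  have hint' : Integrable fun z => spec (warpKernel σ τ v w z • incl (U a z.2 ψ)) :=
    spec.toContinuousLinearMap.integrable_comp hint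
  rw [e1, ← integral_inner hint']
  have i1 : Integrable fun k => inner ℂ (ζ k) (spec (incl ψ) k) := L2.integrable_inner _ _
  have i2 : Integrable (fun q : (R4 × R4) × E4 => (warpKernel σ τ v w q.1 *
      Complex.exp (Complex.I * ((∑ μ, q.1.2 μ * spectralPoint a q.2 μ : ℝ) : ℂ))) *
      inner ℂ (ζ q.2) (spec (incl ψ) q.2)) (volume.prod volume) := by
    have hc : Continuous fun q : (R4 × R4) × E4 =>
        Complex.exp (Complex.I * ((∑ μ, q.1.2 μ * spectralPoint a q.2 μ : ℝ) : ℂ)) := by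
      unfold spectralPoint
      fun_prop
    refine (((integrable_warpKernel hσ hτ v w).mul_prod i1).bdd_mul (c := 1)
      hc.aestronglyMeasurable (.of_forall fun q => ?_)).congr (.of_forall fun q => ?_)
    · rw [mul_comm Complex.I, Complex.norm_exp_ofReal_mul_I]
    · ring
  calc ∫ z, inner ℂ ζ (spec (warpKernel σ τ v w z • incl (U a z.2 ψ)))
      = ∫ z, ∫ k, (warpKernel σ τ v w z *
          Complex.exp (Complex.I * ((∑ μ, z.2 μ * spectralPoint a k μ : ℝ) : ℂ))) *
          inner ℂ (ζ k) (spec (incl ψ) k) := by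
        refine integral_congr_ae (.of_forall fun z => ?_)
        simp only [map_smul, inner_smul_right, mul_assoc]
        rw [L2.inner_def, integral_const_mul]
        congr 1
        refine integral_congr_ae ?_
        filter_upwards [spec_U a z.2 ψ] with k hk
        rw [hk, inner_smul_right]
    _ = ∫ k, ∫ z, (warpKernel σ τ v w z *
          Complex.exp (Complex.I * ((∑ μ, z.2 μ * spectralPoint a k μ : ℝ) : ℂ))) *
          inner ℂ (ζ k) (spec (incl ψ) k) := integral_integral_swap i2
    _ = inner ℂ ζ (hmem.toLp _) := by
        rw [L2.inner_def]
        refine integral_congr_ae ?_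
        filter_upwards [hmem.coeFn_toLp] with k hk
        rw [hk, inner_smul_right, integral_mul_const, integral_warpKernel hσ hτ hvw]

/-- The bound is uniform in σ and τ and involves only the limiting exponential, so it dominates
precisely on the domain of the limit. The term -σ|x|² in the exponent is dropped; dividing by 4στ +
1 ≥ 1 can increase a negative exponent up to 0, hence the summand 1. -/
theorem norm_warpSymbol_le {σ τ s t : ℝ} (hσ : 0 ≤ σ) (hτ : 0 ≤ τ) (hs : σ ≤ s) (ht : τ ≤ t)
    (v w x : R4) : ‖warpSymbol σ τ v w x‖ ≤
      Real.exp (t * ∑ μ, v μ ^ 2 + s * ∑ μ, w μ ^ 2) * (1 + Real.exp (-∑ μ, v μ * x μ)) := by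
  set D : ℝ := 4 * σ * τ + 1 with hD
  have hD1 : 1 ≤ D := by have := mul_nonneg hσ hτ; rw [hD]; linarith
  have hDC : (4 * σ * τ + 1 : ℂ) = (D : ℂ) := by rw [hD]; push_cast; rfl
  set A : ℝ := ∑ μ, v μ ^ 2 with hA
  set B : ℝ := ∑ μ, w μ ^ 2 with hB
  set Y : ℝ := ∑ μ, v μ * x μ with hY
  have hA0 : 0 ≤ A := by positivity
  have hB0 : 0 ≤ B := by positivity
  set Z : ℝ := ∑ μ, x μ ^ 2 with hZ
  have hZ0 : 0 ≤ Z := by positivity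
  have he : (τ * ∑ μ, (v μ : ℂ) ^ 2 - ∑ μ, (v μ : ℂ) * x μ
      + σ * ∑ μ, ((w μ : ℂ) + Complex.I * x μ) ^ 2) / D =
      ((τ * A - Y + σ * (B - Z)) / D : ℝ) + ((2 * σ * ∑ μ, w μ * x μ) / D : ℝ) * Complex.I := by
    have : ∀ μ, ((w μ : ℂ) + Complex.I * x μ) ^ 2 =
        (w μ : ℂ) ^ 2 - (x μ : ℂ) ^ 2 + 2 * (w μ * x μ) * Complex.I := fun μ => by
      linear_combination ((x μ : ℂ) ^ 2) * Complex.I_sq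
    simp only [this, hA, hB, hY, hZ]
    push_cast
    rw [Finset.sum_add_distrib, Finset.sum_sub_distrib, ← Finset.sum_mul, ← Finset.mul_sum]
    ring
  have hn : ‖((D : ℂ) ^ 2)⁻¹‖ ≤ 1 := by
    rw [norm_inv, norm_pow, Complex.norm_real, Real.norm_of_nonneg (by linarith)]
    exact inv_le_one_of_one_le₀ (one_le_pow₀ hD1)
  have hexp : (τ * A - Y + σ * (B - Z)) / D ≤ (t * A + s * B) + max 0 (-Y) := by
    have h1 : (τ * A - Y + σ * (B - Z)) ≤ (t * A + s * B) + max 0 (-Y) := by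
      have := mul_nonneg hσ hZ0
      have := mul_le_mul_of_nonneg_right hs hB0
      have := mul_le_mul_of_nonneg_right ht hA0
      have := le_max_right 0 (-Y)
      linarith
    have h2 : 0 ≤ (t * A + s * B) + max 0 (-Y) := by
      have := mul_nonneg (hσ.trans hs) hB0
      have := mul_nonneg (hτ.trans ht) hA0
      have := le_max_left 0 (-Y)
      linarith
    rw [div_le_iff₀ (by linarith)]
    exact h1.trans (le_mul_of_one_le_right h2 hD1)
  have hmax : Real.exp (max 0 (-Y)) ≤ 1 + Real.exp (-Y) := by
    rcases max_choice 0 (-Y) with h | h <;> rw [h]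
    · simp [(Real.exp_pos (-Y)).le]
    · linarith
  rw [warpSymbol, hDC, he, norm_mul, Complex.exp_add, norm_mul, Complex.norm_exp_ofReal_mul_I,
    mul_one, Complex.norm_exp_ofReal]
  calc _ ≤ 1 * Real.exp ((t * A + s * B) + max 0 (-Y)) := by gcongr
    _ ≤ _ := by
      rw [one_mul, Real.exp_add]
      gcongr

theorem tendsto_warpSymbol (s t : ℝ) (v w x : R4) :
    Tendsto (fun ε : ℝ => warpSymbol (s * ε ^ 2) (t * ε ^ 2) v w x) (𝓝[>] 0)
      (𝓝 (Real.exp (-∑ μ, v μ * x μ) : ℂ)) := by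
  have hc : ContinuousAt (fun ε : ℝ => warpSymbol (s * ε ^ 2) (t * ε ^ 2) v w x) 0 := by
    unfold warpSymbol
    have h : (4 * ((s * (0 : ℝ) ^ 2 : ℝ) : ℂ) * ((t * (0 : ℝ) ^ 2 : ℝ) : ℂ) + 1) ≠ 0 := by simp
    have h1 : ContinuousAt (fun ε : ℝ =>
        ((4 * ((s * ε ^ 2 : ℝ) : ℂ) * ((t * ε ^ 2 : ℝ) : ℂ) + 1) ^ 2)⁻¹) 0 :=
      ContinuousAt.inv₀ (by fun_prop) (pow_ne_zero 2 h)
    refine h1.mul ?_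
    refine ContinuousAt.cexp (ContinuousAt.div ?_ ?_ h) <;> fun_prop
  have h0 : warpSymbol (s * (0 : ℝ) ^ 2) (t * (0 : ℝ) ^ 2) v w x =
      (Real.exp (-∑ μ, v μ * x μ) : ℂ) := by
    simp [warpSymbol]
  rw [← h0]
  exact hc.tendsto.mono_left nhdsWithin_le_nhds

/-- If conjugation by the dilations multiplies `A φ` by exponentials, the warped convolution of `A`
is multiplication by an exponential in the spectral representation. -/
theorem hasWarpedConv_iff {a : R4} {Θ : Matrix (Fin 4) (Fin 4) ℝ} {A : Dom →L[ℂ] Dom}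
    {φ ψ : Dom} {v w : R4} (hvw : ∀ μ, v μ * w μ = 0)
    (hA : ∀ x y, adjointAction a (Θ.mulVec x) A (U a y φ) =
      (Real.exp (-∑ μ, v μ * x μ + ∑ μ, w μ * y μ) : ℂ) • U a y ψ) (ξ : Hilb) :
    HasWarpedConv a Θ A φ ξ ↔ spec ξ =ᵐ[volume] fun k =>
      (Real.exp (-∑ μ, v μ * spectralPoint a k μ) : ℂ) • spec (incl ψ) k := by
  have hker (s t ε : ℝ) : warpedIntegrand a Θ A φ s t ε = fun z =>
      warpKernel (s * ε ^ 2) (t * ε ^ 2) v w z • incl (U a z.2 ψ) := by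
    funext z
    rw [warpedIntegrand, hA, map_smul, smul_smul, warpKernel]
    congr 1
    rw [Complex.ofReal_exp, Complex.ofReal_exp, ← Complex.exp_add, ← Complex.exp_add]
    congr 1
    push_cast
    simp only [Fin.sum_univ_four]
    ring
  set J : ℝ → ℝ → ℝ → Hilb := fun s t ε =>
    (((2 * Real.pi) ^ 4)⁻¹ : ℝ) • ∫ z, warpedIntegrand a Θ A φ s t ε z with hJ
  have hspec {s t ε : ℝ} (hs : 0 < s) (ht : 0 < t) (hε : 0 < ε) :
      spec (J s t ε) =ᵐ[volume] fun k =>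
        warpSymbol (s * ε ^ 2) (t * ε ^ 2) v w (spectralPoint a k) • spec (incl ψ) k := by
    have hσ : 0 < s * ε ^ 2 := by positivity
    have hτ : 0 < t * ε ^ 2 := by positivity
    have e : spec (J s t ε) = ((((2 * Real.pi) ^ 4)⁻¹ : ℝ) : ℂ) •
        spec (∫ z, warpedIntegrand a Θ A φ s t ε z) := by
      simp only [hJ]
      rw [← map_smul, Complex.coe_smul]
      rfl
    rw [e, hker]
    filter_upwards [Lp.coeFn_smul ((((2 * Real.pi) ^ 4)⁻¹ : ℝ) : ℂ)
      (spec (∫ z, warpKernel (s * ε ^ 2) (t * ε ^ 2) v w z • incl (U a z.2 ψ))),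
      spec_integral_warpKernel hσ hτ hvw a ψ] with k h1 h2
    rw [h1, Pi.smul_apply, h2, smul_smul]
    congr 1
    have : (Real.pi : ℂ) ≠ 0 := by exact_mod_cast Real.pi_ne_zero
    push_cast
    field_simp
  constructor
  · intro h
    -- One cut-off suffices in this direction. A subsequence of the L²-convergent family converges
    -- almost everywhere, where its limit is that of the symbols.
    have h1 : Tendsto (J 1 1) (𝓝[>] 0) (𝓝 ξ) := (h 1 1 one_pos one_pos).2
    obtain ⟨u, -, hu0, hu⟩ := exists_seq_strictAnti_tendsto (0 : ℝ)
    have hu' : Tendsto u atTop (𝓝[>] 0) :=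
      tendsto_nhdsWithin_iff.2 ⟨hu, .of_forall hu0⟩
    have h2 : Tendsto (fun n => spec (J 1 1 (u n))) atTop (𝓝 (spec ξ)) :=
      (spec.continuous.tendsto ξ).comp (h1.comp hu')
    obtain ⟨ns, hns, h3⟩ := (tendstoInMeasure_of_tendsto_Lp h2).exists_seq_tendsto_ae
    filter_upwards [h3, ae_all_iff.2 fun n => hspec one_pos one_pos (hu0 n)] with k h4 h5
    refine tendsto_nhds_unique h4 ?_
    simp only [h5]
    exact ((tendsto_warpSymbol 1 1 v w _).comp (hu'.comp hns.tendsto_atTop)).smul_const _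
  · intro h s t hs ht
    refine ⟨fun ε hε => ?_, ?_⟩
    · rw [hker]
      exact integrable_warpKernel_smul (by positivity) (by positivity) a v w ψ
    change Tendsto (J s t) (𝓝[>] 0) (𝓝 ξ)
    rw [spec.isometry.isUniformInducing.isInducing.tendsto_nhds_iff]
    set C : ℝ := Real.exp (t * ∑ μ, v μ ^ 2 + s * ∑ μ, w μ ^ 2) with hC
    have hC1 : 1 ≤ C := Real.one_le_exp (by positivity)
    have hξ : ∀ᵐ k, ‖spec ξ k‖ =
        Real.exp (-∑ μ, v μ * spectralPoint a k μ) * ‖spec (incl ψ) k‖ := by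
      filter_upwards [h] with k hk
      rw [hk, norm_smul, Complex.norm_real, Real.norm_of_nonneg (Real.exp_pos _).le]
    -- By `hξ` the unbounded part of the symbol bound times `spec ψ` is the norm of `spec ξ`, which
    -- is square integrable because ξ is given.
    refine tendsto_Lp_two_of_dominated
      (bound := fun k => C * (‖spec (incl ψ) k‖ + ‖spec ξ k‖))
      (((Lp.memLp (spec (incl ψ))).norm.add (Lp.memLp (spec ξ)).norm).const_mul C)
      (F' := fun ε k => warpSymbol (s * ε ^ 2) (t * ε ^ 2) v w (spectralPoint a k) •
        spec (incl ψ) k) ?_ ?_ ?_ ?_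
    · filter_upwards [self_mem_nhdsWithin] with ε hε using hspec hs ht hε
    · filter_upwards [Ioc_mem_nhdsGT one_pos] with ε hε
      filter_upwards [hξ] with k hk
      have hε2 : ε ^ 2 ≤ 1 := pow_le_one₀ hε.1.le hε.2
      have := norm_warpSymbol_le (σ := s * ε ^ 2) (τ := t * ε ^ 2) (s := s) (t := t)
        (by positivity) (by positivity) (mul_le_of_le_one_right hs.le hε2)
        (mul_le_of_le_one_right ht.le hε2) v w (spectralPoint a k)
      rw [norm_smul, hk]
      calc _ ≤ C * (1 + Real.exp (-∑ μ, v μ * spectralPoint a k μ)) * ‖spec (incl ψ) k‖ := by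
            gcongr
        _ = _ := by ring
    · refine .of_forall fun k => ?_
      have := norm_nonneg (spec ξ k)
      have := norm_nonneg (spec (incl ψ) k)
      nlinarith
    · filter_upwards [h] with k hk
      rw [hk]
      exact (tendsto_warpSymbol s t v w _).smul_const _

/-! ### The deformed metric -/

theorem U_U (a p p' : R4) (φ : Dom) : U a p (U a p' φ) = U a (p + p') φ := by
  ext x
  simp only [U_apply, ← mul_assoc]
  congr 1
  · rw [← Complex.ofReal_mul, ← Real.exp_add]
    simp only [Pi.add_apply, mul_add, Finset.sum_add_distrib, add_div]
  · congr 1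
    funext μ
    rw [← Real.exp_add, Pi.add_apply, mul_add, add_comm]

theorem adjointAction_apply (a p : R4) (A : Dom →L[ℂ] Dom) (φ : Dom) :
    adjointAction a p A φ = U a p (A (U a (-p) φ)) := rfl

theorem P_U (a p : R4) (μ : Fin 4) (φ : Dom) :
    P μ (U a p φ) = (Real.exp (a μ * p μ) : ℂ) • U a p (P μ φ) := by
  ext x
  have hd : HasFDerivAt (U a p φ : R4 → ℂ)
      (((Real.exp ((∑ μ, a μ * p μ) / 2) : ℝ) : ℂ) •
        (fderiv ℝ φ (dilation a p x)).comp (dilation a p : R4 →L[ℝ] R4)) x :=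
    ((φ.differentiableAt (x := dilation a p x)).hasFDerivAt.comp x
      (dilation a p).hasFDerivAt).const_smul _
  have hs : dilation a p (Pi.single μ 1) = Real.exp (a μ * p μ) • (Pi.single μ 1 : R4) := by
    funext ν
    change Real.exp (a ν * p ν) * (Pi.single μ 1 : R4) ν = _
    by_cases h : ν = μ
    · subst h; simp
    · simp [h]
  rw [P_apply, hd.fderiv]
  change -Complex.I * (((Real.exp ((∑ μ, a μ * p μ) / 2) : ℝ) : ℂ) *
    (fderiv ℝ φ (dilation a p x)) (dilation a p (Pi.single μ 1))) = _
  rw [hs, map_smul, Complex.real_smul]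
  change _ = (Real.exp (a μ * p μ) : ℂ) * U a p (P μ φ) x
  rw [U_apply, P_apply]
  change _ = ((Real.exp (a μ * p μ) : ℝ) : ℂ) * (((Real.exp ((∑ μ, a μ * p μ) / 2) : ℝ) : ℂ) *
    (-Complex.I * fderiv ℝ φ (dilation a p x) (Pi.single μ 1)))
  ring

theorem dX_mul_dX_apply (a q : R4) (μ : Fin 4) (φ : Dom) :
    (dX a q μ * dX a q μ) φ = ((q μ : ℂ) * a μ) ^ 2 • P μ (P μ φ) := by
  rw [dX_eq, smul_mul_smul_comm, sq]
  rfl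

/-- dX^μ is a multiple of P^μ, and each of the two momenta picks up e^{a^μ p_μ}. -/
theorem smul_dX_mul_dX_U (c : ℂ) (a q p : R4) (μ : Fin 4) (φ : Dom) :
    (c • (dX a q μ * dX a q μ)) (U a p φ) =
      (Real.exp (2 * a μ * p μ) : ℂ) • U a p ((c • (dX a q μ * dX a q μ)) φ) := by
  have h : (Real.exp (a μ * p μ) : ℂ) * Real.exp (a μ * p μ) = Real.exp (2 * a μ * p μ) := by
    rw [← Complex.ofReal_mul, ← Real.exp_add]
    congr 2
    ring
  simp only [smul_apply, dX_mul_dX_apply, P_U, map_smul, smul_smul]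
  congr 1
  rw [← h]
  ring

/-- The metric `η_{μν} exp(-2 a^μ Θ_{μλ} x^λ)`. -/
def deformedMetric (a : R4) (Θ : Matrix (Fin 4) (Fin 4) ℝ) (x : R4) : Matrix (Fin 4) (Fin 4) ℝ :=
  Matrix.diagonal fun μ => η μ μ * Real.exp (-∑ ν, 2 * a μ * Θ μ ν * x ν)

theorem η_of_ne {μ ν : Fin 4} (h : μ ≠ ν) : η μ ν = 0 := Matrix.diagonal_apply_ne _ h

theorem measurable_deformedMetric (a : R4) (Θ : Matrix (Fin 4) (Fin 4) ℝ) (μ ν : Fin 4) :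
    Measurable fun x => deformedMetric a Θ x μ ν := by
  by_cases h : μ = ν
  · subst h
    simp only [deformedMetric, Matrix.diagonal_apply_eq]
    fun_prop
  · simp only [deformedMetric, Matrix.diagonal_apply_ne _ h]
    exact measurable_const

theorem spec_const_smul (c : ℂ) (f : Hilb) : spec (c • f) =ᵐ[volume] fun k => c • spec f k := by
  rw [map_smul]
  exact Lp.coeFn_smul c (spec f)

theorem spec_eq_zero_iff (ξ : Hilb) : spec ξ =ᵐ[volume] (fun _ => (0 : Fiber)) ↔ ξ = 0 := by
  rw [← map_eq_zero_iff spec spec.injective, Lp.eq_zero_iff_ae_eq_zero]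
  rfl

/-- Limits add, so convergence passes from the summands to the sum; this argument gives no converse,
which is why the full line-element is treated in one direction. -/
theorem HasWarpedConv.sum {ι : Type*} (s : Finset ι) {a : R4} {Θ : Matrix (Fin 4) (Fin 4) ℝ}
    {A : ι → Dom →L[ℂ] Dom} {φ : Dom} {ξ : ι → Hilb}
    (h : ∀ i ∈ s, HasWarpedConv a Θ (A i) φ (ξ i)) :
    HasWarpedConv a Θ (∑ i ∈ s, A i) φ (∑ i ∈ s, ξ i) := by
  intro c t hc ht
  have e (ε : ℝ) : warpedIntegrand a Θ (∑ i ∈ s, A i) φ c t ε =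
      fun z => ∑ i ∈ s, warpedIntegrand a Θ (A i) φ c t ε z := by
    funext z
    simp only [warpedIntegrand, adjointAction, Finset.mul_sum, Finset.sum_mul,
      sum_apply, map_sum, Finset.smul_sum]
  have hi (ε : ℝ) (hε : 0 < ε) : ∀ i ∈ s, Integrable (warpedIntegrand a Θ (A i) φ c t ε) :=
    fun i his => (h i his c t hc ht).1 ε hε
  refine ⟨fun ε hε => ?_, ?_⟩
  · rw [e]
    exact integrable_finsetSum _ (hi ε hε)
  · refine (tendsto_finsetSum s fun i his => (h i his c t hc ht).2).congr' ?_
    filter_upwards [self_mem_nhdsWithin] with ε hε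
    rw [e, integral_finsetSum _ (hi ε hε), Finset.smul_sum]

theorem isDeformedMetric_deformedMetric {a : R4} (ha : ∀ μ, a μ ≠ 0) (q : R4)
    {Θ : Matrix (Fin 4) (Fin 4) ℝ} (hΘ : Θ.transpose = -Θ) :
    IsDeformedMetric a q Θ (deformedMetric a Θ) := by
  have hdiag (μ : Fin 4) : Θ μ μ = 0 := by
    have := congrFun (congrFun hΘ μ) μ
    simp only [Matrix.transpose_apply, Matrix.neg_apply] at this
    linarith
  have main (μ ν φ ξ) : HasWarpedConv a Θ ((η μ ν : ℂ) • (dX a q μ * dX a q ν)) φ ξ ↔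
      HasFun a (fun x => deformedMetric a Θ x μ ν) ((dX a q μ * dX a q ν) φ) ξ := by
    rw [hasFun_iff ha (measurable_deformedMetric a Θ μ ν)]
    by_cases h : μ = ν
    · subst h
      -- Moving A past U(y - Θx) produces e^{2a^μ(y - Θx)_μ}; v and w collect the coefficients of x
      -- and y.
      set v : R4 := fun ν => 2 * a μ * Θ μ ν with hv
      set w : R4 := Pi.single μ (2 * a μ) with hw
      have hvw (ν : Fin 4) : v ν * w ν = 0 := by
        by_cases h : ν = μ
        · subst h; simp [hv, hdiag]
        · simp [hw, h]
      rw [hasWarpedConv_iff hvw (ψ := ((η μ μ : ℂ) • (dX a q μ * dX a q μ)) φ)]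
      · rw [smul_apply, map_smul]
        have h2 : (fun k => (Real.exp (-∑ ν, v ν * spectralPoint a k ν) : ℂ) •
              spec ((η μ μ : ℂ) • incl ((dX a q μ * dX a q μ) φ)) k) =ᵐ[volume]
            fun k => (deformedMetric a Θ (spectralPoint a k) μ μ : ℂ) •
              spec (incl ((dX a q μ * dX a q μ) φ)) k := by
          filter_upwards [spec_const_smul (η μ μ : ℂ) (incl ((dX a q μ * dX a q μ) φ))] with k hk
          rw [hk, smul_smul, deformedMetric, Matrix.diagonal_apply_eq, Complex.ofReal_mul, mul_comm]
        exact ⟨fun h => h.trans h2, fun h => h.trans h2.symm⟩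
      · intro x y
        rw [adjointAction_apply, U_U, smul_dX_mul_dX_U, map_smul, U_U, add_neg_cancel_left]
        congr 3
        have e1 : ∑ ν, v ν * x ν = 2 * a μ * Θ.mulVec x μ := by
          simp only [hv, Matrix.mulVec, dotProduct, Finset.mul_sum, mul_assoc]
        have e2 : ∑ ν, w ν * y ν = 2 * a μ * y μ := by
          rw [Finset.sum_eq_single μ] <;> simp +contextual [hw]
        rw [e1, e2, Pi.add_apply, Pi.neg_apply]
        ring
    -- Off the diagonal both operators vanish, and both sides reduce to ξ = 0.
    · simp only [deformedMetric, Matrix.diagonal_apply_ne _ h, Complex.ofReal_zero, zero_smul,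
        spec_eq_zero_iff, η_of_ne h]
      rw [hasWarpedConv_iff (v := 0) (w := 0) (ψ := 0) (by simp)]
      · simp only [map_zero]
        rw [← spec_eq_zero_iff]
        have h2 : (fun k => (Real.exp (-∑ ν, (0 : R4) ν * spectralPoint a k ν) : ℂ) •
            (0 : Spec) k) =ᵐ[volume] fun _ => (0 : Fiber) := by
          filter_upwards [Lp.coeFn_zero Fiber 2 (volume : Measure E4)] with k hk
          rw [hk, Pi.zero_apply, smul_zero]
        exact ⟨fun h => h.trans h2, fun h => h.trans h2.symm⟩
      · intro x y
        simp [adjointAction]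
  refine ⟨main, ?_⟩
  rintro φ ξ ⟨ζ, hζ, rfl⟩
  exact HasWarpedConv.sum _ fun μ _ => HasWarpedConv.sum _ fun ν _ => (main μ ν φ _).2 (hζ μ ν)

/-! ### Strong convergence -/

/-- If `e^{-rL} g` is square integrable for the relevant small `r`, it tends to `g`. -/
theorem tendsto_exp_smul_aux {g : Spec} {L : E4 → ℝ} {Z : ℝ → Spec}
    {p : ℝ → Prop} (hp : ∀ r, p r → Z r =ᵐ[volume] fun k => (Real.exp (-(r * L k)) : ℂ) • g k)
    (hnp : ∀ r, ¬ p r → Z r = g) : Tendsto Z (𝓝[≥] 0) (𝓝 g) := by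
  classical
  -- If some r₀ > 0 is admissible, e^{-rL} ≤ 1 + e^{-r₀L} on [0, r₀], according to the sign of L.
  -- Otherwise r = 0 is the only admissible value to bound.
  obtain ⟨h, hbound⟩ : ∃ h : Spec, ∀ᶠ r in 𝓝[≥] (0 : ℝ), p r →
      ∀ᵐ k, ‖(Real.exp (-(r * L k)) : ℂ) • g k‖ ≤ ‖g k‖ + ‖h k‖ := by
    by_cases hex : ∃ r₀, 0 < r₀ ∧ p r₀
    · obtain ⟨r₀, hr₀, hpr₀⟩ := hex
      refine ⟨Z r₀, ?_⟩
      filter_upwards [Icc_mem_nhdsGE hr₀] with r hr _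
      filter_upwards [hp r₀ hpr₀] with k hk
      rw [hk, norm_smul, norm_smul, Complex.norm_real, Complex.norm_real,
        Real.norm_of_nonneg (Real.exp_pos _).le, Real.norm_of_nonneg (Real.exp_pos _).le]
      have : Real.exp (-(r * L k)) ≤ 1 + Real.exp (-(r₀ * L k)) := by
        rcases le_total 0 (L k) with h | h
        · have : Real.exp (-(r * L k)) ≤ 1 :=
            Real.exp_le_one_iff.2 (neg_nonpos.2 (mul_nonneg hr.1 h))
          have := Real.exp_pos (-(r₀ * L k))
          linarith
        · have : Real.exp (-(r * L k)) ≤ Real.exp (-(r₀ * L k)) :=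
            Real.exp_le_exp.2 (neg_le_neg (mul_le_mul_of_nonpos_right hr.2 h))
          linarith
      calc _ ≤ (1 + Real.exp (-(r₀ * L k))) * ‖g k‖ := by gcongr
        _ = _ := by ring
    · refine ⟨0, ?_⟩
      filter_upwards [self_mem_nhdsWithin] with r hr hpr
      obtain rfl : r = 0 := by
        by_contra hne
        exact hex ⟨r, lt_of_le_of_ne hr (Ne.symm hne), hpr⟩
      exact .of_forall fun k => by simp
  refine tendsto_Lp_two_of_dominated (F' := fun r k => if p r then
      (Real.exp (-(r * L k)) : ℂ) • g k else g k) ((Lp.memLp g).norm.add (Lp.memLp h).norm)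
      (.of_forall fun r => ?_) ?_ (.of_forall fun k => ?_) (.of_forall fun k => ?_)
  · by_cases hr : p r
    · simpa only [hr, if_true] using hp r hr
    · simp only [hr, if_false, hnp r hr]
      rfl
  · filter_upwards [hbound] with r hr
    by_cases hpr : p r
    · simpa only [hpr, if_true, Pi.add_apply] using hr hpr
    · simp only [hpr, if_false]
      exact .of_forall fun k => by simp
  · simp
  · refine Tendsto.if' ?_ tendsto_const_nhds
    have hc : Continuous fun r : ℝ => (Real.exp (-(r * L k)) : ℂ) • g k := by fun_prop
    have := (hc.tendsto 0).mono_left (nhdsWithin_le_nhds (s := Set.Ici 0))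
    simpa using this

/-- Dominated convergence needs a countably generated filter, while l is arbitrary. The family is
therefore factored through its parameter r near 0, with the default value g where e^{-rL}g is not
square integrable. The two signs of r are exchanged by L ↦ -L. -/
theorem tendsto_of_exp_smul {ι : Type*} {l : Filter ι} {g : Spec} {L : E4 → ℝ}
    {r : ι → ℝ} (hr : Tendsto r l (𝓝 0)) {ζ : ι → Spec}
    (hζ : ∀ᶠ i in l, ζ i =ᵐ[volume] fun k => (Real.exp (-(r i * L k)) : ℂ) • g k) :
    Tendsto ζ l (𝓝 g) := by
  classical
  set p : ℝ → Prop := fun r => ∃ f : Spec, f =ᵐ[volume] fun k => (Real.exp (-(r * L k)) : ℂ) • g k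
  set Z : ℝ → Spec := fun r => if h : p r then h.choose else g
  have hp (r : ℝ) (h : p r) : Z r =ᵐ[volume] fun k => (Real.exp (-(r * L k)) : ℂ) • g k := by
    simp only [Z, h, dif_pos]
    exact h.choose_spec
  have hnp (r : ℝ) (h : ¬ p r) : Z r = g := by simp only [Z, h, dif_neg, not_false_eq_true]
  have h1 := tendsto_exp_smul_aux hp hnp
  have h2 : Tendsto (fun r => Z (-r)) (𝓝[≥] 0) (𝓝 g) :=
    tendsto_exp_smul_aux (L := fun k => -L k) (p := fun r => p (-r))
      (fun r h => by simpa using hp (-r) h) (fun r h => hnp (-r) h)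
  have h3 : Tendsto Z (𝓝[≤] 0) (𝓝 g) := by
    have hneg : Tendsto (fun r : ℝ => -r) (𝓝[≤] 0) (𝓝[≥] 0) := by
      refine tendsto_nhdsWithin_iff.2 ⟨?_, ?_⟩
      · simpa using (continuous_neg.tendsto (0 : ℝ)).mono_left (nhdsWithin_le_nhds (s := Set.Iic 0))
      · filter_upwards [self_mem_nhdsWithin] with r hr
        exact neg_nonneg.2 (Set.mem_Iic.1 hr)
    simpa [Function.comp_def] using h2.comp hneg
  have h4 : Tendsto Z (𝓝 0) (𝓝 g) := by
    rw [← nhdsLE_sup_nhdsGE]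
    exact h3.sup h1
  refine (h4.comp hr).congr' ?_
  filter_upwards [hζ] with i hi
  exact Lp.ext ((hp (r i) ⟨ζ i, hi⟩).trans hi.symm)

/-! ### Tensor products of Schwartz functions -/

open scoped ContDiff in
/-- The product of Schwartz functions of the coordinates. -/
def tensor (f : Fin 4 → 𝓢(ℝ, ℂ)) : Dom where
  toFun x := ∏ μ, f μ (x μ)
  smooth' := contDiff_prod fun μ _ =>
    ((f μ).smooth ⊤).comp (ContinuousLinearMap.proj (R := ℝ) (φ := fun _ : Fin 4 => ℝ) μ).contDiff
  decay' k n := by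
    set π : (μ : Fin 4) → R4 →L[ℝ] ℝ :=
      fun μ => ContinuousLinearMap.proj (R := ℝ) (φ := fun _ : Fin 4 => ℝ) μ with hπ
    have hbound (m : ℕ) : ∃ C, ∀ μ (x : ℝ), (1 + ‖x‖) ^ k * ‖iteratedFDeriv ℝ m (f μ) x‖ ≤ C := by
      choose C hC using fun μ => (f μ).decay 0 m
      choose C' hC' using fun μ => (f μ).decay k m
      refine ⟨∑ μ, 2 ^ k * (|C μ| + |C' μ|), fun μ x => ?_⟩
      have h1 : (1 + ‖x‖) ^ k ≤ 2 ^ k * (1 + ‖x‖ ^ k) := by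
        have := add_pow_le zero_le_one (norm_nonneg x) k
        rw [one_pow] at this
        refine this.trans ?_
        gcongr
        · norm_num
        · omega
      have h2 := (hC μ).2 x
      have h3 := (hC' μ).2 x
      rw [pow_zero, one_mul] at h2
      calc (1 + ‖x‖) ^ k * ‖iteratedFDeriv ℝ m (f μ) x‖
          ≤ 2 ^ k * (1 + ‖x‖ ^ k) * ‖iteratedFDeriv ℝ m (f μ) x‖ := by gcongr
        _ = 2 ^ k * (‖iteratedFDeriv ℝ m (f μ) x‖ + ‖x‖ ^ k * ‖iteratedFDeriv ℝ m (f μ) x‖) := by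
          ring
        _ ≤ 2 ^ k * (|C μ| + |C' μ|) := by
          gcongr
          · exact h2.trans (le_abs_self _)
          · exact h3.trans (le_abs_self _)
        _ ≤ _ := Finset.single_le_sum (f := fun μ => 2 ^ k * (|C μ| + |C' μ|))
          (fun _ _ => by positivity) (Finset.mem_univ μ)
    choose C hC using hbound
    have hcomp (μ : Fin 4) (m : ℕ) (x : R4) :
        ‖iteratedFDeriv ℝ m (fun x : R4 => f μ (x μ)) x‖ ≤ ‖iteratedFDeriv ℝ m (f μ) (x μ)‖ := by
      have h := (π μ).iteratedFDeriv_comp_right ((f μ).smooth ⊤) x (i := m) (by exact_mod_cast le_top)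
      have h' : iteratedFDeriv ℝ m (fun x : R4 => f μ (x μ)) x =
          (iteratedFDeriv ℝ m (f μ) (x μ)).compContinuousLinearMap fun _ => π μ := h
      rw [h']
      refine (ContinuousMultilinearMap.norm_compContinuousLinearMap_le _ _).trans ?_
      have hn : ‖π μ‖ ≤ 1 := ContinuousLinearMap.opNorm_le_bound _ zero_le_one fun x => by
        rw [one_mul]; exact norm_le_pi_norm x μ
      exact mul_le_of_le_one_right (norm_nonneg _)
        (Finset.prod_le_one (fun _ _ => norm_nonneg _) fun _ _ => hn)
    -- The weight is split into one factor per coordinate, each at least 1, so that every factor of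
    -- a Leibniz term absorbs its own.
    have hxk (x : R4) : ‖x‖ ^ k ≤ ∏ μ, (1 + ‖x μ‖) ^ k := by
      rw [Finset.prod_pow]
      gcongr
      refine (pi_norm_le_iff_of_nonneg (Finset.prod_nonneg fun _ _ => by positivity)).2 fun μ => ?_
      refine (le_add_of_nonneg_left zero_le_one).trans ?_
      rw [← Finset.mul_prod_erase _ _ (Finset.mem_univ μ)]
      refine le_mul_of_one_le_right (by positivity) ?_
      rw [← Finset.prod_const_one (s := Finset.univ.erase μ)]
      exact Finset.prod_le_prod (fun _ _ => zero_le_one) fun ν _ => by simp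
    refine ⟨∑ p ∈ (Finset.univ : Finset (Fin 4)).sym n, ((p : Multiset (Fin 4)).countPerms : ℝ) *
      ∏ μ, C ((p : Multiset (Fin 4)).count μ), fun x => ?_⟩
    have hle := norm_iteratedFDeriv_prod_le (𝕜 := ℝ) (u := Finset.univ) (N := ∞) (n := n) (x := x)
      (f := fun μ (x : R4) => f μ (x μ))
      (fun μ _ => ((f μ).smooth ⊤).comp (π μ).contDiff) (by exact_mod_cast le_top)
    calc _ ≤ (∏ μ, (1 + ‖x μ‖) ^ k) * ∑ p ∈ (Finset.univ : Finset (Fin 4)).sym n,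
          ((p : Multiset (Fin 4)).countPerms : ℝ) * ∏ μ, ‖iteratedFDeriv ℝ
            ((p : Multiset (Fin 4)).count μ) (fun x : R4 => f μ (x μ)) x‖ :=
        mul_le_mul (hxk x) hle (norm_nonneg _) (Finset.prod_nonneg fun _ _ => by positivity)
      _ = ∑ p ∈ (Finset.univ : Finset (Fin 4)).sym n, ((p : Multiset (Fin 4)).countPerms : ℝ) *
          ∏ μ, (1 + ‖x μ‖) ^ k * ‖iteratedFDeriv ℝ
            ((p : Multiset (Fin 4)).count μ) (fun x : R4 => f μ (x μ)) x‖ := by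
        rw [Finset.mul_sum]
        refine Finset.sum_congr rfl fun p _ => ?_
        rw [Finset.prod_mul_distrib]
        ring
      _ ≤ _ := by
        gcongr with p _ μ _
        refine le_trans ?_ (hC _ μ (x μ))
        gcongr
        exact hcomp μ _ x

theorem tensor_apply (f : Fin 4 → 𝓢(ℝ, ℂ)) (x : R4) : tensor f x = ∏ μ, f μ (x μ) := rfl

theorem P_tensor (f : Fin 4 → 𝓢(ℝ, ℂ)) (μ : Fin 4) :
    P μ (tensor f) =
      (-Complex.I) • tensor (Function.update f μ (SchwartzMap.derivCLM ℂ ℂ (f μ))) := by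
  ext x
  have h1 : HasDerivAt (fun t => tensor f (Function.update x μ t))
      (fderiv ℝ (tensor f) x (Pi.single μ 1)) (x μ) := by
    have h := (tensor f).differentiableAt (x := x) |>.hasFDerivAt
    rw [← Function.update_eq_self μ x] at h
    have := h.comp_hasDerivAt (x μ) (hasDerivAt_update x μ (x μ))
    rwa [Function.update_eq_self] at this
  have h2 : (fun t => tensor f (Function.update x μ t)) =
      fun t => f μ t * ∏ ν ∈ Finset.univ.erase μ, f ν (x ν) := by
    funext t
    rw [tensor_apply, ← Finset.mul_prod_erase _ _ (Finset.mem_univ μ), Function.update_self]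
    congr 1
    refine Finset.prod_congr rfl fun ν hν => ?_
    rw [Function.update_of_ne (Finset.ne_of_mem_erase hν)]
  have h3 := h1.unique (h2 ▸ (f μ).differentiableAt.hasDerivAt.mul_const _)
  rw [P_apply, h3]
  change _ = -Complex.I * tensor _ x
  rw [tensor_apply, ← Finset.mul_prod_erase _ _ (Finset.mem_univ μ), Function.update_self,
    SchwartzMap.derivCLM_apply]
  congr 2
  refine Finset.prod_congr rfl fun ν hν => ?_
  rw [Function.update_of_ne (Finset.ne_of_mem_erase hν)]

/-! ### Gaussians in logarithmic coordinates -/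

open Polynomial in
/-- The function `p(log x) x^β exp(-(log x)² / 2)` on the half-line of sign `e`. -/
def logGauss (e : ℤˣ) (p : ℂ[X]) (β : ℂ) (x : ℝ) : ℂ :=
  if 0 < ((e : ℤ) : ℝ) * x then
    p.eval (Real.log x : ℂ) * Complex.exp (β * Real.log x - (Real.log x : ℂ) ^ 2 / 2)
  else 0

open Polynomial in
theorem exists_bound_polynomial_mul_exp (p : ℂ[X]) (c : ℝ) {δ : ℝ} (hδ : 0 < δ) :
    ∃ C, ∀ u : ℝ, ‖p.eval (u : ℂ)‖ * Real.exp (c * u - δ * u ^ 2) ≤ C := by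
  induction p using Polynomial.induction_on' with
  | add p q hp hq =>
    obtain ⟨C, hC⟩ := hp
    obtain ⟨C', hC'⟩ := hq
    refine ⟨C + C', fun u => ?_⟩
    rw [eval_add]
    calc _ ≤ (‖p.eval (u : ℂ)‖ + ‖q.eval (u : ℂ)‖) * Real.exp (c * u - δ * u ^ 2) := by
          gcongr; exact norm_add_le _ _
      _ ≤ _ := by rw [add_mul]; exact add_le_add (hC u) (hC' u)
  | monomial n a =>
    -- The factorial comes from |u|^n ≤ n! e^{|u|}; the exponential is the maximum of (|c| + 1)|u| -
    -- δu².
    refine ⟨‖a‖ * (n.factorial * Real.exp ((|c| + 1) ^ 2 / (4 * δ))), fun u => ?_⟩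
    rw [eval_monomial, norm_mul, norm_pow, Complex.norm_real, Real.norm_eq_abs, mul_assoc]
    refine mul_le_mul_of_nonneg_left ?_ (norm_nonneg a)
    have h1 : |u| ^ n ≤ n.factorial * Real.exp |u| := by
      have := Real.pow_div_factorial_le_exp |u| (abs_nonneg u) n
      rwa [div_le_iff₀ (by positivity), mul_comm] at this
    have h2 : |u| + (c * u - δ * u ^ 2) ≤ (|c| + 1) ^ 2 / (4 * δ) := by
      rw [le_div_iff₀ (by positivity)]
      have h3 : c * u ≤ |c| * |u| := by rw [← abs_mul]; exact le_abs_self _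
      have h4 : u ^ 2 = |u| ^ 2 := (sq_abs u).symm
      rw [h4]
      nlinarith [sq_nonneg (2 * δ * |u| - (|c| + 1)), mul_le_mul_of_nonneg_left h3 hδ.le]
    calc _ ≤ (n.factorial * Real.exp |u|) * Real.exp (c * u - δ * u ^ 2) := by gcongr
      _ = n.factorial * Real.exp (|u| + (c * u - δ * u ^ 2)) := by rw [Real.exp_add]; ring
      _ ≤ _ := by gcongr

open Polynomial in
theorem exists_bound_logGauss (e : ℤˣ) (p : ℂ[X]) (β : ℂ) : ∃ C, ∀ x, ‖logGauss e p β x‖ ≤ C := by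
  obtain ⟨C, hC⟩ := exists_bound_polynomial_mul_exp p β.re (δ := 1 / 2) (by norm_num)
  refine ⟨C, fun x => ?_⟩
  unfold logGauss
  split_ifs with h
  · refine le_trans (le_of_eq ?_) (hC (Real.log x))
    rw [norm_mul, Complex.norm_exp]
    congr 2
    have : (Real.log x : ℂ) ^ 2 / 2 = ((Real.log x ^ 2 / 2 : ℝ) : ℂ) := by push_cast; rfl
    rw [Complex.sub_re, Complex.re_mul_ofReal, this, Complex.ofReal_re]
    ring
  · rw [norm_zero]
    exact le_trans (by positivity) (hC 0)

open Polynomial in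
-- Powers of |x| = e^{log|x|} are absorbed into β, so boundedness for all β already gives rapid
-- decay.
theorem norm_pow_mul_logGauss (e : ℤˣ) (p : ℂ[X]) (β : ℂ) (k : ℕ) (x : ℝ) :
    ‖x‖ ^ k * ‖logGauss e p β x‖ = ‖logGauss e p (β + k) x‖ := by
  unfold logGauss
  split_ifs with h
  · have hx : x ≠ 0 := fun h0 => by simp [h0] at h
    rw [norm_mul, norm_mul, mul_left_comm]
    congr 1
    rw [Real.norm_eq_abs, ← Real.exp_log_eq_abs hx, ← Real.exp_nat_mul, Complex.norm_exp,
      Complex.norm_exp, ← Real.exp_add]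
    congr 1
    simp
    ring
  · simp

open Polynomial in
-- On the half-line, 1/x is the sign e times e^{-log|x|}, so differentiation changes the polynomial
-- and lowers β by one. The family is thus closed under differentiation, including at the origin,
-- where all members are flat.
theorem hasDerivAt_logGauss (e : ℤˣ) (p : ℂ[X]) (β : ℂ) (x : ℝ) :
    HasDerivAt (logGauss e p β)
      (logGauss e (C ((e : ℤ) : ℂ) * (derivative p + (C β - Polynomial.X) * p)) (β - 1) x) x := by
  have hc : Continuous fun y : ℝ => ((e : ℤ) : ℝ) * y := by fun_prop
  rcases lt_trichotomy 0 (((e : ℤ) : ℝ) * x) with h | h | h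
  · have hx : x ≠ 0 := fun h0 => by simp [h0] at h
    have hl : HasDerivAt (fun y : ℝ => (Real.log y : ℂ)) ((x⁻¹ : ℝ) : ℂ) x :=
      (Real.hasDerivAt_log hx).ofReal_comp
    have hd := ((p.hasDerivAt (Real.log x : ℂ)).comp x hl).mul
      ((hl.const_mul β).sub ((hl.pow 2).div_const 2)).cexp
    have heq : logGauss e p β =ᶠ[𝓝 x] fun y => p.eval (Real.log y : ℂ) *
        Complex.exp (β * Real.log y - (Real.log y : ℂ) ^ 2 / 2) := by
      filter_upwards [hc.continuousAt.eventually_mem (Ioi_mem_nhds h)] with y hy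
      exact if_pos hy
    refine (hd.congr_of_eventuallyEq heq).congr_deriv ?_
    have hexp : ((e : ℤ) : ℂ) * Complex.exp (-(Real.log x : ℂ)) = ((x⁻¹ : ℝ) : ℂ) := by
      rw [← Complex.ofReal_neg, ← Complex.ofReal_exp, Real.exp_neg, Real.exp_log_eq_abs hx]
      rcases Int.units_eq_one_or e with he | he
      · rw [he] at h ⊢
        rw [abs_of_pos (by simpa using h)]
        simp
      · rw [he] at h ⊢
        rw [abs_of_neg (by simpa using h)]
        simp
    rw [logGauss, if_pos h, ← hexp]
    have hsplit : (β - 1) * (Real.log x : ℂ) - (Real.log x : ℂ) ^ 2 / 2 =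
        -(Real.log x : ℂ) + (β * Real.log x - (Real.log x : ℂ) ^ 2 / 2) := by ring
    rw [hsplit, Complex.exp_add]
    simp only [eval_mul, eval_add, eval_sub, eval_C, eval_X, Function.comp_apply, Pi.pow_apply,
      Pi.sub_apply]
    push_cast
    ring
  · have hx : x = 0 := by
      rcases mul_eq_zero.1 h.symm with h0 | h0
      · exact absurd h0 (sign_ne_zero e)
      · exact h0
    subst hx
    -- Lowering β by 2 exhibits the function as O(y²), which forces derivative zero at the origin.
    obtain ⟨B, hB⟩ := exists_bound_logGauss e p (β - 2)
    have hO : logGauss e p β =O[𝓝 0] fun y => ‖y - 0‖ ^ 2 := by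
      refine Asymptotics.IsBigO.of_bound B (.of_forall fun y => ?_)
      have h1 := norm_pow_mul_logGauss e p (β - 2) 2 y
      rw [Nat.cast_ofNat, sub_add_cancel] at h1
      rw [← h1, sub_zero, norm_pow, norm_norm, mul_comm]
      gcongr
      exact hB y
    have h0 : logGauss e (C ((e : ℤ) : ℂ) * (derivative p + (C β - Polynomial.X) * p)) (β - 1) 0 =
        0 := by simp [logGauss]
    rw [h0]
    simpa using (hO.hasFDerivAt one_lt_two).hasDerivAt
  · rw [logGauss, if_neg h.not_gt]
    refine (hasDerivAt_const x (0 : ℂ)).congr_of_eventuallyEq ?_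
    filter_upwards [hc.continuousAt.eventually_mem (Iio_mem_nhds h)] with y hy
    exact if_neg (not_lt.2 (le_of_lt hy))

open Polynomial in
/-- The polynomial factor of the derivative of `logGauss`. -/
def logGaussDeriv (e : ℤˣ) (p : ℂ[X]) (β : ℂ) : ℂ[X] :=
  C ((e : ℤ) : ℂ) * (derivative p + (C β - Polynomial.X) * p)

open Polynomial in
theorem deriv_logGauss (e : ℤˣ) (p : ℂ[X]) (β : ℂ) :
    deriv (logGauss e p β) = logGauss e (logGaussDeriv e p β) (β - 1) :=
  funext fun x => (hasDerivAt_logGauss e p β x).deriv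

open Polynomial in
theorem iteratedDeriv_logGauss (e : ℤˣ) (n : ℕ) : ∀ (p : ℂ[X]) (β : ℂ),
    ∃ q γ, iteratedDeriv n (logGauss e p β) = logGauss e q γ := by
  induction n with
  | zero => exact fun p β => ⟨p, β, iteratedDeriv_zero⟩
  | succ n ih =>
    intro p β
    rw [iteratedDeriv_succ', deriv_logGauss]
    exact ih _ _

open Polynomial in
/-- `logGauss` as a Schwartz function. -/
def logGaussS (e : ℤˣ) (p : ℂ[X]) (β : ℂ) : 𝓢(ℝ, ℂ) where
  toFun := logGauss e p β
  smooth' := contDiff_of_differentiable_iteratedDeriv fun n _ => by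
    obtain ⟨q, γ, h⟩ := iteratedDeriv_logGauss e n p β
    rw [h]
    exact fun x => (hasDerivAt_logGauss e q γ x).differentiableAt
  decay' k n := by
    obtain ⟨q, γ, h⟩ := iteratedDeriv_logGauss e n p β
    obtain ⟨B, hB⟩ := exists_bound_logGauss e q (γ + k)
    refine ⟨B, fun x => ?_⟩
    rw [norm_iteratedFDeriv_eq_norm_iteratedDeriv, h, norm_pow_mul_logGauss]
    exact hB x

open Polynomial in
theorem derivCLM_logGaussS (e : ℤˣ) (p : ℂ[X]) (β : ℂ) :
    SchwartzMap.derivCLM ℂ ℂ (logGaussS e p β) = logGaussS e (logGaussDeriv e p β) (β - 1) := by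
  ext x
  rw [SchwartzMap.derivCLM_apply]
  exact congrFun (deriv_logGauss e p β) x

open Polynomial in
/-- Products of `logGauss` functions, supported in one orthant. -/
def logGaussProd (s : Orthant) (p : Fin 4 → ℂ[X]) (β : Fin 4 → ℂ) : Dom :=
  tensor fun μ => logGaussS (s μ) (p μ) (β μ)

open Polynomial in
/-- A Gaussian with a polynomial and an exponential factor. -/
def polyGauss (p : ℂ[X]) (γ : ℂ) (u : ℝ) : ℂ :=
  p.eval (u : ℂ) * Complex.exp (γ * u - (u : ℂ) ^ 2 / 2)

open Polynomial in
theorem logGauss_sign_mul_exp (e e' : ℤˣ) (p : ℂ[X]) (β : ℂ) (u : ℝ) :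
    logGauss e p β (((e' : ℤ) : ℝ) * Real.exp u) = if e' = e then polyGauss p β u else 0 := by
  have hlog : Real.log (((e' : ℤ) : ℝ) * Real.exp u) = u := by
    rcases Int.units_eq_one_or e' with h | h <;> simp [h]
  have hpos : 0 < ((e : ℤ) : ℝ) * (((e' : ℤ) : ℝ) * Real.exp u) ↔ e' = e := by
    have := Real.exp_pos u
    rcases Int.units_eq_one_or e with h | h <;> rcases Int.units_eq_one_or e' with h' | h' <;>
      simp [h, h', this, this.le]
  simp only [logGauss, hpos, hlog, polyGauss]

open Polynomial in
theorem continuous_polyGauss (p : ℂ[X]) (γ : ℂ) : Continuous (polyGauss p γ) := by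
  unfold polyGauss
  have := p.continuous
  fun_prop

open Polynomial in
theorem integrable_polyGauss (p : ℂ[X]) (γ : ℂ) : Integrable (polyGauss p γ) := by
  -- Half of the Gaussian e^{-u²/2} controls the polynomial; the other half remains integrable.
  obtain ⟨B, hB⟩ := exists_bound_polynomial_mul_exp p 0 (δ := 1 / 4) (by norm_num)
  have h1 := integrable_cexp_quadratic (b := 1 / 4) (by norm_num) γ 0
  refine (h1.norm.const_mul B).mono' (continuous_polyGauss p γ).aestronglyMeasurable
    (.of_forall fun u => ?_)
  have h2 : γ * u - (u : ℂ) ^ 2 / 2 =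
      ((0 * u - 1 / 4 * u ^ 2 : ℝ) : ℂ) + (-(1 / 4) * (u : ℂ) ^ 2 + γ * u + 0) := by
    push_cast; ring
  rw [polyGauss, h2, Complex.exp_add, norm_mul, norm_mul, ← mul_assoc, Complex.norm_exp_ofReal]
  gcongr
  exact hB u

/-- The shift of β by 1/2 is the square root of the Jacobian. -/
theorem mellinFun_logGaussProd (s : Orthant) (p : Fin 4 → Polynomial ℂ) (β : Fin 4 → ℂ) (u : E4) :
    mellinFun (logGaussProd s p β) u =
      EuclideanSpace.single s (∏ μ, polyGauss (p μ) (β μ + 1 / 2) (u μ)) := by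
  ext t
  have h1 : mellinFun (logGaussProd s p β) u t = (Real.exp ((∑ μ, u μ) / 2) : ℂ) *
      ∏ μ, if t μ = s μ then polyGauss (p μ) (β μ) (u μ) else 0 := by
    simp only [← logGauss_sign_mul_exp]
    rfl
  rw [h1, PiLp.single_apply]
  by_cases h : t = s
  · subst h
    simp only [if_true]
    rw [Finset.sum_div, Real.exp_sum, Complex.ofReal_prod, ← Finset.prod_mul_distrib]
    refine Finset.prod_congr rfl fun μ _ => ?_
    rw [polyGauss, polyGauss, mul_left_comm, Complex.ofReal_exp, ← Complex.exp_add]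
    congr 2
    push_cast
    ring
  · obtain ⟨μ, hμ⟩ := Function.ne_iff.1 h
    rw [if_neg h, Finset.prod_eq_zero (Finset.mem_univ μ) (if_neg hμ), mul_zero]

/-! ### Spectral images of the log-Gaussians -/

theorem integrable_prod_E4 {f : Fin 4 → ℝ → ℂ} (hf : ∀ μ, Integrable (f μ)) :
    Integrable fun u : E4 => ∏ μ, f μ (u μ) :=
  ((PiLp.volume_preserving_ofLp (Fin 4)).integrable_comp_emb
    (MeasurableEquiv.toLp 2 (Fin 4 → ℝ)).symm.measurableEmbedding).2 (Integrable.fintype_prod hf)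

theorem integral_prod_E4 (f : Fin 4 → ℝ → ℂ) :
    ∫ u : E4, ∏ μ, f μ (u μ) = ∏ μ, ∫ t, f μ t := by
  rw [← integral_fintype_prod_volume_eq_prod]
  exact (PiLp.volume_preserving_ofLp (Fin 4)).integral_comp
    (MeasurableEquiv.toLp 2 (Fin 4 → ℝ)).symm.measurableEmbedding (fun x => ∏ μ, f μ (x μ))

open scoped FourierTransform in
theorem fourier_prod_E4 (f : Fin 4 → ℝ → ℂ) (k : E4) :
    𝓕 (fun u : E4 => ∏ μ, f μ (u μ)) k = ∏ μ, 𝓕 (f μ) (k μ) := by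
  simp only [Real.fourier_eq', smul_eq_mul]
  rw [← integral_prod_E4]
  refine integral_congr_ae (.of_forall fun u => ?_)
  simp only
  rw [Finset.prod_mul_distrib, ← Complex.exp_sum, PiLp.inner_apply]
  congr 2
  simp only [Finset.mul_sum, Finset.sum_mul, Complex.ofReal_sum]

open scoped FourierTransform in
theorem coeFn_spec {φ : Dom} (h : Integrable (mellinFun φ)) :
    spec (incl φ) =ᵐ[volume] 𝓕 (mellinFun φ) := by
  have hae := coeFn_mellin (coeFn_incl φ)
  have hmem : MemLp (mellinFun φ) 2 volume := (memLp_congr_ae hae).1 (Lp.memLp _)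
  have e : mellin (incl φ) = hmem.toLp _ := Lp.ext (hae.trans hmem.coeFn_toLp.symm)
  have h2 := coeFn_fourier_toLp h hmem
  rw [← e] at h2
  exact h2

open scoped FourierTransform in
theorem spec_logGaussProd (s : Orthant) (p : Fin 4 → Polynomial ℂ) (β : Fin 4 → ℂ) :
    spec (incl (logGaussProd s p β)) =ᵐ[volume] fun k =>
      EuclideanSpace.single s (∏ μ, 𝓕 (polyGauss (p μ) (β μ + 1 / 2)) (k μ)) := by
  have hg : Integrable fun u : E4 => ∏ μ, polyGauss (p μ) (β μ + 1 / 2) (u μ) :=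
    integrable_prod_E4 fun μ => integrable_polyGauss _ _
  have hint : Integrable (mellinFun (logGaussProd s p β)) := by
    refine hg.mono (measurable_mellinFun
      (logGaussProd s p β).continuous.measurable).aestronglyMeasurable (.of_forall fun u => ?_)
    rw [mellinFun_logGaussProd, PiLp.norm_single]
  filter_upwards [coeFn_spec hint] with k hk
  rw [hk, ← fourier_prod_E4, Real.fourier_eq', Real.fourier_eq']
  have e (u : E4) : Complex.exp (((-2 * Real.pi * inner ℝ u k : ℝ) : ℂ) * Complex.I) •
      mellinFun (logGaussProd s p β) u =
        (Complex.exp (((-2 * Real.pi * inner ℝ u k : ℝ) : ℂ) * Complex.I) •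
          ∏ μ, polyGauss (p μ) (β μ + 1 / 2) (u μ)) • EuclideanSpace.single s (1 : ℂ) := by
    rw [mellinFun_logGaussProd]
    ext t
    simp [PiLp.single_apply]
  simp only [e]
  rw [integral_smul_const]
  ext t
  simp [PiLp.single_apply]

open scoped FourierTransform in
theorem fourier_polyGauss_one (γ : ℂ) (κ : ℝ) : 𝓕 (polyGauss 1 γ) κ =
    (2 * Real.pi : ℂ) ^ (1 / 2 : ℂ) * Complex.exp ((γ - 2 * Real.pi * Complex.I * κ) ^ 2 / 2) := by
  have h := integral_cexp_quadratic (b := -(1 / 2)) (by norm_num)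
    (γ - 2 * Real.pi * Complex.I * κ) 0
  have e1 : (Real.pi : ℂ) / -(-(1 / 2)) = 2 * Real.pi := by ring
  have e2 : 0 - (γ - 2 * Real.pi * Complex.I * κ) ^ 2 / (4 * (-(1 / 2) : ℂ)) =
      (γ - 2 * Real.pi * Complex.I * κ) ^ 2 / 2 := by ring
  rw [e1, e2] at h
  rw [← h, Real.fourier_real_eq_integral_exp_smul]
  refine integral_congr_ae (.of_forall fun u => ?_)
  simp only [polyGauss, Polynomial.eval_one, one_mul, smul_eq_mul]
  rw [← Complex.exp_add]
  congr 1
  push_cast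
  ring

open scoped FourierTransform in
-- For a pure Gaussian, completing the square turns the real exponential into an imaginary shift of
-- γ and a constant. With a polynomial factor only the trivial case c = 0 is needed.
theorem exp_mul_fourier_polyGauss {p : Polynomial ℂ} {c : ℝ} (h : p = 1 ∨ c = 0) (γ : ℂ) (κ : ℝ) :
    (Real.exp (-(2 * Real.pi * c * κ)) : ℂ) * 𝓕 (polyGauss p γ) κ =
      Complex.exp (Complex.I * c * γ + c ^ 2 / 2) * 𝓕 (polyGauss p (γ - Complex.I * c)) κ := by
  rcases h with rfl | rfl
  · rw [fourier_polyGauss_one, fourier_polyGauss_one, mul_left_comm, mul_left_comm (Complex.exp _),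
      Complex.ofReal_exp, ← Complex.exp_add, ← Complex.exp_add]
    congr 2
    push_cast
    linear_combination (-(c : ℂ) ^ 2 / 2 - 2 * Real.pi * c * κ) * Complex.I_sq
  · simp

/-- `spec` is available only as an isometric embedding, so a preimage has to be exhibited: the
log-Gaussian with β shifted by -i a^μ v_μ, times a constant. -/
theorem exists_spec_eq_exp_smul (a v : R4) (s : Orthant) (p : Fin 4 → Polynomial ℂ)
    (β : Fin 4 → ℂ) (h : ∀ μ, p μ = 1 ∨ v μ = 0) : ∃ ξ : Hilb, spec ξ =ᵐ[volume] fun k =>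
      (Real.exp (-∑ μ, v μ * spectralPoint a k μ) : ℂ) •
        spec (incl (logGaussProd s p β)) k := by
  set c : R4 := fun μ => a μ * v μ with hc
  refine ⟨(∏ μ, Complex.exp (Complex.I * c μ * (β μ + 1 / 2) + c μ ^ 2 / 2)) •
    incl (logGaussProd s p fun μ => β μ - Complex.I * c μ), ?_⟩
  filter_upwards [spec_const_smul (∏ μ, Complex.exp (Complex.I * c μ * (β μ + 1 / 2) + c μ ^ 2 / 2))
    (incl (logGaussProd s p fun μ => β μ - Complex.I * c μ)), spec_logGaussProd s p β,
    spec_logGaussProd s p fun μ => β μ - Complex.I * c μ] with k h1 h2 h3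
  rw [h1, h2, h3]
  ext t
  simp only [PiLp.smul_apply, PiLp.single_apply, smul_eq_mul, mul_ite, mul_zero]
  split_ifs
  · rw [← Finset.sum_neg_distrib, Real.exp_sum, Complex.ofReal_prod, ← Finset.prod_mul_distrib,
      ← Finset.prod_mul_distrib]
    refine Finset.prod_congr rfl fun μ _ => ?_
    have h4 := exp_mul_fourier_polyGauss (p := p μ) (c := c μ)
      ((h μ).imp_right fun h => by simp [hc, h]) (β μ + 1 / 2) (k μ)
    have e1 : v μ * spectralPoint a k μ = 2 * Real.pi * c μ * k μ := by
      simp only [spectralPoint, hc]; ring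
    have e2 : β μ - Complex.I * c μ + 1 / 2 = β μ + 1 / 2 - Complex.I * c μ := by ring
    rw [e1, e2, h4]
  · rfl

/-! ### Linearity of f(X) and the common domain -/

theorem HasFun.add {a : R4} (ha : ∀ μ, a μ ≠ 0) {f : R4 → ℝ} (hf : Measurable f) {ψ ψ' : Dom}
    {ξ ξ' : Hilb} (h : HasFun a f ψ ξ) (h' : HasFun a f ψ' ξ') :
    HasFun a f (ψ + ψ') (ξ + ξ') := by
  rw [hasFun_iff ha hf] at h h' ⊢
  rw [map_add, map_add, map_add]
  filter_upwards [h, h', Lp.coeFn_add (spec ξ) (spec ξ'),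
    Lp.coeFn_add (spec (incl ψ)) (spec (incl ψ'))] with k h1 h2 h3 h4
  rw [h3, h4, Pi.add_apply, Pi.add_apply, h1, h2, smul_add]

theorem HasFun.smul {a : R4} (ha : ∀ μ, a μ ≠ 0) {f : R4 → ℝ} (hf : Measurable f) {ψ : Dom}
    {ξ : Hilb} (c : ℂ) (h : HasFun a f ψ ξ) : HasFun a f (c • ψ) (c • ξ) := by
  rw [hasFun_iff ha hf] at h ⊢
  rw [map_smul incl]
  filter_upwards [h, spec_const_smul c ξ, spec_const_smul c (incl ψ)] with k h1 h2 h3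
  rw [h2, h3, h1, smul_comm]

theorem P_logGaussProd (μ : Fin 4) (s : Orthant) (p : Fin 4 → Polynomial ℂ) (β : Fin 4 → ℂ) :
    P μ (logGaussProd s p β) = (-Complex.I) • logGaussProd s
      (Function.update p μ (logGaussDeriv (s μ) (p μ) (β μ)))
      (Function.update β μ (β μ - 1)) := by
  rw [logGaussProd, P_tensor, derivCLM_logGaussS]
  congr 2
  funext ν
  by_cases h : ν = μ
  · subst h; simp
  · simp [h]

theorem exists_hasFun_deformedMetric {a : R4} (ha : ∀ μ, a μ ≠ 0)
    {Θ : Matrix (Fin 4) (Fin 4) ℝ} (μ : Fin 4) (s : Orthant) (p : Fin 4 → Polynomial ℂ)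
    (β : Fin 4 → ℂ) (h : ∀ ν, p ν = 1 ∨ Θ μ ν = 0) :
    ∃ ξ, HasFun a (fun x => deformedMetric a Θ x μ μ) (logGaussProd s p β) ξ := by
  obtain ⟨ξ, hξ⟩ := exists_spec_eq_exp_smul a (fun ν => 2 * a μ * Θ μ ν) s p β
    fun ν => (h ν).imp_right fun h => by simp [h]
  refine ⟨(η μ μ : ℂ) • ξ, (hasFun_iff ha (measurable_deformedMetric a Θ μ μ) _ _).2 ?_⟩
  filter_upwards [hξ, spec_const_smul (η μ μ : ℂ) ξ] with k h1 h2
  rw [h2, h1, smul_smul, deformedMetric, Matrix.diagonal_apply_eq, Complex.ofReal_mul]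

/-- The two derivatives create a polynomial only in coordinate μ, and Θ_{μμ} = 0 keeps that
coordinate out of the exponent. -/
theorem exists_hasFun_dX_mul_dX {a : R4} (ha : ∀ μ, a μ ≠ 0) (q : R4)
    {Θ : Matrix (Fin 4) (Fin 4) ℝ} (hΘ : Θ.transpose = -Θ) (μ ν : Fin 4) (s : Orthant)
    (β : Fin 4 → ℂ) : ∃ ξ, HasFun a (fun x => deformedMetric a Θ x μ ν)
      ((dX a q μ * dX a q ν) (logGaussProd s 1 β)) ξ := by
  by_cases h : μ = ν
  · subst h
    have hdiag : Θ μ μ = 0 := by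
      have := congrFun (congrFun hΘ μ) μ
      simp only [Matrix.transpose_apply, Matrix.neg_apply] at this
      linarith
    rw [dX_mul_dX_apply, P_logGaussProd, map_smul, P_logGaussProd, Function.update_idem,
      Function.update_idem, smul_smul, smul_smul]
    have hp (p : Polynomial ℂ) (ν : Fin 4) :
        Function.update (1 : Fin 4 → Polynomial ℂ) μ p ν = 1 ∨ Θ μ ν = 0 := by
      by_cases hν : ν = μ
      · exact Or.inr (hν ▸ hdiag)
      · exact Or.inl (Function.update_of_ne hν _ _)
    exact ⟨_, (exists_hasFun_deformedMetric ha μ s _ _ (hp _)).choose_spec.smul ha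
      (measurable_deformedMetric a Θ μ μ) _⟩
  · refine ⟨0, (hasFun_iff ha (measurable_deformedMetric a Θ μ ν) _ _).2 ?_⟩
    simp only [deformedMetric, Matrix.diagonal_apply_ne _ h, Complex.ofReal_zero, zero_smul]
    rw [spec_eq_zero_iff]

open scoped FourierTransform in
/-- The log-Gaussian functions span a dense subspace of `L²`. -/
theorem eq_zero_of_inner_logGaussProd (ζ : Hilb)
    (h : ∀ s β, inner ℂ (incl (logGaussProd s 1 β)) ζ = 0) : ζ = 0 := by
  have hcomp (s : Orthant) : ∀ᵐ u, mellin ζ u s = 0 := by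
    set G : E4 → ℂ := fun u => (∏ μ, polyGauss 1 0 (u μ)) * mellin ζ u s with hG
    -- In β the -1/2 cancels the Jacobian shift, and the imaginary part, conjugated by the inner
    -- product, becomes the Fourier character at x.
    have key (x : E4) : (fun u => inner ℂ (mellin (incl (logGaussProd s 1 fun μ =>
        2 * Real.pi * Complex.I * x μ - 1 / 2)) u) (mellin ζ u)) =ᵐ[volume] fun u =>
        Complex.exp (((-2 * Real.pi * inner ℝ u x : ℝ) : ℂ) * Complex.I) • G u := by
      filter_upwards [coeFn_mellin (coeFn_incl (logGaussProd s 1 fun μ =>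
        2 * Real.pi * Complex.I * x μ - 1 / 2))] with u hu
      rw [hu, mellinFun_logGaussProd, EuclideanSpace.inner_single_left, map_prod, smul_eq_mul, hG]
      simp only
      rw [← mul_assoc, PiLp.inner_apply, Finset.mul_sum, Complex.ofReal_sum, Finset.sum_mul,
        Complex.exp_sum, ← Finset.prod_mul_distrib]
      congr 1
      refine Finset.prod_congr rfl fun μ _ => ?_
      simp only [polyGauss, Pi.one_apply, Polynomial.eval_one, one_mul, ← Complex.exp_conj,
        ← Complex.exp_add]
      congr 1
      simp only [map_sub, map_mul, map_add, map_div₀, map_pow, Complex.conj_I, Complex.conj_ofReal,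
        map_one, map_ofNat, RCLike.inner_apply, conj_trivial]
      push_cast
      ring
    have hGi : Integrable G := by
      refine (L2.integrable_inner (𝕜 := ℂ) _ (mellin ζ)).congr ((key 0).trans ?_)
      exact .of_forall fun u => by simp
    have hG0 : G =ᵐ[volume] 0 := by
      refine ae_eq_zero_of_fourier_eq_zero hGi fun x => ?_
      rw [Real.fourier_eq', ← integral_congr_ae (key x), ← L2.inner_def, mellin.inner_map_map, h]
    filter_upwards [hG0] with u hu
    refine (mul_eq_zero.1 hu).resolve_left (Finset.prod_ne_zero_iff.2 fun μ _ => ?_)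
    simp [polyGauss]
  rw [← map_eq_zero_iff mellin mellin.injective, Lp.eq_zero_iff_ae_eq_zero]
  filter_upwards [ae_all_iff.2 hcomp] with u hu
  ext s
  exact hu s

theorem hasFun_zero {a : R4} (ha : ∀ μ, a μ ≠ 0) {f : R4 → ℝ} (hf : Measurable f) :
    HasFun a f 0 0 := by
  rw [hasFun_iff ha hf, map_zero, map_zero, map_zero]
  filter_upwards [Lp.coeFn_zero Fiber 2 (volume : Measure E4)] with k hk
  rw [hk, Pi.zero_apply, smul_zero]

theorem HasFun.unique {a : R4} (ha : ∀ μ, a μ ≠ 0) {f : R4 → ℝ} (hf : Measurable f) {ψ : Dom}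
    {ξ ξ' : Hilb} (h : HasFun a f ψ ξ) (h' : HasFun a f ψ ξ') : ξ = ξ' := by
  rw [hasFun_iff ha hf] at h h'
  exact spec.injective (Lp.ext (h.trans h'.symm))

/-- The common domain of the deformed line-elements and time-time components is dense. -/
theorem dense_domain {ι : Type*} {a : ι → R4} (ha : ∀ k μ, a k μ ≠ 0) (q : R4)
    {Θ : Matrix (Fin 4) (Fin 4) ℝ} (hΘ : Θ.transpose = -Θ) :
    Dense {f : Hilb | ∃ φ, incl φ = f ∧ ∀ k,
      (∃ ξ, HasLineElement (a k) q (deformedMetric (a k) Θ) φ ξ) ∧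
      (∃ ξ, HasFun (a k) (fun x => deformedMetric (a k) Θ x 0 0) φ ξ)} := by
  have hm (k μ ν) := measurable_deformedMetric (a k) Θ μ ν
  let S : Submodule ℂ Dom :=
    { carrier := {φ | ∀ k, (∀ μ ν, ∃ ζ, HasFun (a k) (fun x => deformedMetric (a k) Θ x μ ν)
        ((dX (a k) q μ * dX (a k) q ν) φ) ζ) ∧
        ∃ ξ, HasFun (a k) (fun x => deformedMetric (a k) Θ x 0 0) φ ξ}
      add_mem' := fun {φ φ'} h h' k => by
        refine ⟨fun μ ν => ?_, ?_⟩
        · obtain ⟨ζ, hζ⟩ := (h k).1 μ ν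
          obtain ⟨ζ', hζ'⟩ := (h' k).1 μ ν
          rw [map_add]
          exact ⟨_, hζ.add (ha k) (hm k μ ν) hζ'⟩
        · obtain ⟨ξ, hξ⟩ := (h k).2
          obtain ⟨ξ', hξ'⟩ := (h' k).2
          exact ⟨_, hξ.add (ha k) (hm k 0 0) hξ'⟩
      zero_mem' := fun k =>
        ⟨fun μ ν => ⟨0, by rw [map_zero]; exact hasFun_zero (ha k) (hm k μ ν)⟩,
          0, hasFun_zero (ha k) (hm k 0 0)⟩
      smul_mem' := fun c φ h k => by
        refine ⟨fun μ ν => ?_, ?_⟩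
        · obtain ⟨ζ, hζ⟩ := (h k).1 μ ν
          rw [map_smul]
          exact ⟨_, hζ.smul (ha k) (hm k μ ν) c⟩
        · obtain ⟨ξ, hξ⟩ := (h k).2
          exact ⟨_, hξ.smul (ha k) (hm k 0 0) c⟩ }
  -- The log-Gaussians do not depend on k and lie in the domains for every a^μ at once.
  have hS (s : Orthant) (β : Fin 4 → ℂ) : logGaussProd s 1 β ∈ S := fun k =>
    ⟨fun μ ν => exists_hasFun_dX_mul_dX (ha k) q hΘ μ ν s β,
      exists_hasFun_deformedMetric (ha k) 0 s 1 β fun _ => Or.inl rfl⟩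
  have hd : Dense ((S.map (incl : Dom →ₗ[ℂ] Hilb) : Submodule ℂ Hilb) : Set Hilb) := by
    rw [Submodule.dense_iff_topologicalClosure_eq_top, Submodule.topologicalClosure_eq_top_iff,
      Submodule.eq_bot_iff]
    intro ζ hζ
    exact eq_zero_of_inner_logGaussProd ζ fun s β =>
      (Submodule.mem_orthogonal _ _).1 hζ _ ⟨_, hS s β, rfl⟩
  refine hd.mono ?_
  rintro _ ⟨φ, hφ, rfl⟩
  refine ⟨φ, rfl, fun k => ⟨?_, (hφ k).2⟩⟩
  choose ζ hζ using (hφ k).1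
  exact ⟨_, ζ, hζ, rfl⟩

/-! ### Comparison with the Friedmann-Robertson-Walker metric -/

theorem lower_zero (a : R4) : lower a 0 = a 0 := by
  simp [lower, η, Matrix.diagonal_apply]

theorem lower_succ (a : R4) (i : Fin 3) : lower a i.succ = -a i.succ := by
  rw [lower, Finset.sum_eq_single i.succ]
  · fin_cases i <;> simp [η]
  · intro ν _ h
    rw [η_of_ne h.symm, zero_mul]
  · simp

/-- In a spatial row only Θ_{i0} survives, and the signs from skew-symmetry and from lowering the
index give -2a^iΘ_{i0} = 2a^iΘ_{0i} = -2a_iΘ_{0i} = H. -/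
theorem deformedMetric_eq {a : R4} {Θ : Matrix (Fin 4) (Fin 4) ℝ} {H : ℝ}
    (hΘ : Θ.transpose = -Θ) (h_mixed : ∀ i : Fin 3, 2 * lower a i.succ * Θ 0 i.succ = -H)
    (h_space : ∀ i j : Fin 3, Θ i.succ j.succ = 0) (x : R4) (μ ν : Fin 4) :
    deformedMetric a Θ x μ ν =
      (if μ = 0 ∧ ν = 0 then
        Real.exp (-2 * ∑ i : Fin 3, lower a 0 * Θ 0 i.succ * x i.succ) else 1) *
      frwMetric H x μ ν := by
  have hskew (μ ν) : Θ μ ν = -Θ ν μ := congrFun (congrFun hΘ ν) μ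
  by_cases h : μ = ν
  · subst h
    rw [deformedMetric, frwMetric, Matrix.diagonal_apply_eq, Matrix.diagonal_apply_eq,
      Fin.sum_univ_succ]
    induction μ using Fin.cases with
    | zero =>
      have h00 : Θ 0 0 = 0 := by linarith [hskew 0 0]
      simp only [and_self, if_true, h00, lower_zero, η, Matrix.diagonal_apply_eq,
        Matrix.cons_val_zero, one_mul, mul_one]
      congr 1
      rw [mul_zero, zero_mul, zero_add, Finset.mul_sum, ← Finset.sum_neg_distrib]
      exact Finset.sum_congr rfl fun i _ => by ring
    | succ i =>
      have h1 := h_mixed i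
      rw [lower_succ] at h1
      have h2 : -(2 * a i.succ * Θ i.succ 0 * x 0 +
          ∑ j : Fin 3, 2 * a i.succ * Θ i.succ j.succ * x j.succ) = H * x 0 := by
        simp only [h_space, mul_zero, zero_mul, Finset.sum_const_zero, add_zero]
        rw [hskew i.succ 0]
        linear_combination (-x 0) * h1
      rw [h2, if_neg (by simp), one_mul]
      fin_cases i <;> simp [η]
  · rw [deformedMetric, frwMetric, Matrix.diagonal_apply_ne _ h, Matrix.diagonal_apply_ne _ h,
      mul_zero]

theorem measurable_frwMetric (H : ℝ) (μ ν : Fin 4) : Measurable fun x => frwMetric H x μ ν := by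
  by_cases h : μ = ν
  · subst h
    simp only [frwMetric, Matrix.diagonal_apply_eq]
    fin_cases μ <;> simp <;> fun_prop
  · simp only [frwMetric, Matrix.diagonal_apply_ne _ h]
    exact measurable_const

/-- When only `a⁰` varies, the exponent of the time-time component in the spectral representation
is a fixed function times a parameter that tends to zero. -/
theorem exists_exponent_eq_mul {ι : Type*} {l : Filter ι} {a : ι → R4}
    {Θ : Matrix (Fin 4) (Fin 4) ℝ}
    (hspatial : ∀ k k' (i : Fin 3), a k i.succ = a k' i.succ) (hΘ : Θ.transpose = -Θ)
    (h_time : ∀ i : Fin 3, Tendsto (fun k => lower (a k) 0 * Θ 0 i.succ) l (𝓝 0)) :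
    ∃ (r : ι → ℝ) (L : E4 → ℝ), Tendsto r l (𝓝 0) ∧
      ∀ k κ, deformedMetric (a k) Θ (spectralPoint (a k) κ) 0 0 = Real.exp (-(r k * L κ)) := by
  have h00 : Θ 0 0 = 0 := by
    have := congrFun (congrFun hΘ 0) 0
    simp only [Matrix.transpose_apply, Matrix.neg_apply] at this
    linarith
  have hg (k : ι) (κ : E4) : deformedMetric (a k) Θ (spectralPoint (a k) κ) 0 0 =
      Real.exp (-(a k 0 * ∑ i : Fin 3, 2 * Θ 0 i.succ *
        (2 * Real.pi * a k i.succ * κ i.succ))) := by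
    rw [deformedMetric, Matrix.diagonal_apply_eq, Fin.sum_univ_succ, h00, Finset.mul_sum]
    simp only [η, Matrix.diagonal_apply_eq, Matrix.cons_val_zero, one_mul, mul_zero, zero_mul,
      zero_add, spectralPoint]
    congr 2
    exact Finset.sum_congr rfl fun i _ => by ring
  rcases isEmpty_or_nonempty ι with hι | ⟨⟨k₀⟩⟩
  · exact ⟨fun _ => 0, fun _ => 0, tendsto_const_nhds, fun k => (hι.false k).elim⟩
  -- If some Θ_{0i} is non-zero, dividing by it shows a^0 → 0, and L is built from the common
  -- spatial a^i; otherwise the exponent vanishes identically.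
  by_cases hz : ∃ i : Fin 3, Θ 0 i.succ ≠ 0
  · obtain ⟨i, hi⟩ := hz
    refine ⟨fun k => a k 0, fun κ => ∑ i : Fin 3, 2 * Θ 0 i.succ *
        (2 * Real.pi * a k₀ i.succ * κ i.succ), ?_, fun k κ => ?_⟩
    · have := (h_time i).div_const (Θ 0 i.succ)
      simpa [lower_zero, mul_div_assoc, hi] using this
    · rw [hg]
      simp only [hspatial k k₀]
  · push Not at hz
    refine ⟨fun _ => 0, fun _ => 0, tendsto_const_nhds, fun k κ => ?_⟩
    rw [hg]
    simp [hz]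

theorem tendstoLocallyUniformly_deformedMetric {ι : Type*} {l : Filter ι} {a : ι → R4}
    {Θ : Matrix (Fin 4) (Fin 4) ℝ} {H : ℝ} (hΘ : Θ.transpose = -Θ)
    (h_time : ∀ i : Fin 3, Tendsto (fun k => lower (a k) 0 * Θ 0 i.succ) l (𝓝 0))
    (h_mixed : ∀ k (i : Fin 3), 2 * lower (a k) i.succ * Θ 0 i.succ = -H)
    (h_space : ∀ i j : Fin 3, Θ i.succ j.succ = 0) (μ ν : Fin 4) :
    TendstoLocallyUniformly (fun k x => deformedMetric (a k) Θ x μ ν)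
      (fun x => frwMetric H x μ ν) l := by
  simp only [deformedMetric_eq hΘ (h_mixed _) h_space]
  by_cases h : μ = 0 ∧ ν = 0
  · obtain ⟨rfl, rfl⟩ := h
    have h1 (x : R4) : frwMetric H x 0 0 = 1 := rfl
    simp only [and_self, if_true, h1, mul_one]
    rw [tendstoLocallyUniformly_iff_forall_tendsto]
    intro x
    have h2 : Tendsto (fun y : ι × R4 => Real.exp (-2 * ∑ i : Fin 3,
        lower (a y.1) 0 * Θ 0 i.succ * y.2 i.succ)) (l ×ˢ 𝓝 x) (𝓝 1) := by
      have h3 (i : Fin 3) : Tendsto (fun y : ι × R4 =>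
          lower (a y.1) 0 * Θ 0 i.succ * y.2 i.succ) (l ×ˢ 𝓝 x) (𝓝 (0 * x i.succ)) :=
        ((h_time i).comp tendsto_fst).mul
          (((continuous_apply i.succ).tendsto x).comp tendsto_snd)
      have h4 := (tendsto_finsetSum Finset.univ fun i _ => h3 i).const_mul (-2)
      simpa using h4.rexp
    exact (tendsto_const_nhds.prodMk_nhds h2).mono_right (nhds_le_uniformity 1)
  · simp only [if_neg h, one_mul]
    intro u hu x
    exact ⟨Set.univ, univ_mem, .of_forall fun k y _ => refl_mem_uniformity hu⟩

/-- The time-time component tends strongly to the identity. -/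
theorem tendsto_hasFun_deformedMetric {ι : Type*} {l : Filter ι} {a : ι → R4}
    {Θ : Matrix (Fin 4) (Fin 4) ℝ} (ha : ∀ k μ, a k μ ≠ 0)
    (hspatial : ∀ k k' (i : Fin 3), a k i.succ = a k' i.succ) (hΘ : Θ.transpose = -Θ)
    (h_time : ∀ i : Fin 3, Tendsto (fun k => lower (a k) 0 * Θ 0 i.succ) l (𝓝 0))
    (ψ : Dom) (ξ : ι → Hilb)
    (hξ : ∀ᶠ k in l, HasFun (a k) (fun x => deformedMetric (a k) Θ x 0 0) ψ (ξ k)) :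
    Tendsto ξ l (𝓝 (incl ψ)) := by
  obtain ⟨r, L, hr, hL⟩ := exists_exponent_eq_mul hspatial hΘ h_time
  rw [spec.isometry.isUniformInducing.isInducing.tendsto_nhds_iff]
  refine tendsto_of_exp_smul (L := L) hr ?_
  filter_upwards [hξ] with k hk
  rw [hasFun_iff (ha k) (measurable_deformedMetric _ _ _ _)] at hk
  simpa only [hL, Function.comp_apply] using hk

/-- All terms but the time-time one cancel. Dividing (dX^0)²φ by (a_0)² leaves a vector χ
independent of k, so the claim is the strong convergence of g_00(X_k) on χ. -/
theorem tendsto_lineElement_sub {ι : Type*} {l : Filter ι} {a : ι → R4} {q : R4}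
    {Θ : Matrix (Fin 4) (Fin 4) ℝ} {H : ℝ} (ha : ∀ k μ, a k μ ≠ 0)
    (hspatial : ∀ k k' (i : Fin 3), a k i.succ = a k' i.succ) (hΘ : Θ.transpose = -Θ)
    (h_time : ∀ i : Fin 3, Tendsto (fun k => lower (a k) 0 * Θ 0 i.succ) l (𝓝 0))
    (h_mixed : ∀ k (i : Fin 3), 2 * lower (a k) i.succ * Θ 0 i.succ = -H)
    (h_space : ∀ i j : Fin 3, Θ i.succ j.succ = 0) (φ : Dom) (ξ ξ' : ι → Hilb)
    (hξ : ∀ᶠ k in l, HasLineElement (a k) q (deformedMetric (a k) Θ) φ (ξ k))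
    (hξ' : ∀ᶠ k in l, HasLineElement (a k) q (frwMetric H) φ (ξ' k)) :
    Tendsto (fun k => ((lower (a k) 0 ^ 2)⁻¹ : ℝ) • (ξ k - ξ' k)) l (𝓝 0) := by
  have hm (k μ ν) := measurable_deformedMetric (a k) Θ μ ν
  set χ : Dom := ((q 0 : ℂ) ^ 2) • P 0 (P 0 φ) with hχ
  have hdX (k : ι) : (((lower (a k) 0 ^ 2)⁻¹ : ℝ) : ℂ) • (dX (a k) q 0 * dX (a k) q 0) φ = χ := by
    rw [dX_mul_dX_apply, smul_smul, lower_zero, hχ]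
    congr 1
    have : (a k 0 : ℂ) ≠ 0 := by exact_mod_cast ha k 0
    push_cast
    field_simp
  have hr (r : ℝ) (x : Hilb) : r • x = (r : ℂ) • x := rfl
  -- Adding χ back makes this vector g_00(X_k)χ, since the FRW time-time component is 1.
  set ω : ι → Hilb := fun k => ((lower (a k) 0 ^ 2)⁻¹ : ℝ) • (ξ k - ξ' k) + incl χ with hω
  have key : ∀ᶠ k in l, HasFun (a k) (fun x => deformedMetric (a k) Θ x 0 0) χ (ω k) := by
    filter_upwards [hξ, hξ'] with k hk hk'
    obtain ⟨ζ, hζ, e⟩ := hk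
    obtain ⟨ζ', hζ', e'⟩ := hk'
    have hoff (μ ν : Fin 4) (h : ¬ (μ = 0 ∧ ν = 0)) : ζ μ ν = ζ' μ ν := by
      have h1 := hζ μ ν
      simp only [deformedMetric_eq hΘ (h_mixed k) h_space, if_neg h, one_mul] at h1
      exact h1.unique (ha k) (measurable_frwMetric H μ ν) (hζ' μ ν)
    have hsub : ξ k - ξ' k = ζ 0 0 - ζ' 0 0 := by
      rw [e, e', ← Finset.sum_sub_distrib, Finset.sum_eq_single 0]
      · rw [← Finset.sum_sub_distrib, Finset.sum_eq_single 0]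
        · intro ν _ hν
          rw [hoff 0 ν (fun h => hν h.2), sub_self]
        · simp
      · intro μ _ hμ
        rw [← Finset.sum_sub_distrib]
        exact Finset.sum_eq_zero fun ν _ => by rw [hoff μ ν (fun h => hμ h.1), sub_self]
      · simp
    have h1 : HasFun (a k) (fun x => frwMetric H x 0 0) ((dX (a k) q 0 * dX (a k) q 0) φ)
        (incl ((dX (a k) q 0 * dX (a k) q 0) φ)) := by
      rw [hasFun_iff (ha k) (measurable_frwMetric H 0 0)]
      exact .of_forall fun κ => by simp [frwMetric]
    have h2 := h1.unique (ha k) (measurable_frwMetric H 0 0) (hζ' 0 0)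
    have h3 : ω k = (((lower (a k) 0 ^ 2)⁻¹ : ℝ) : ℂ) • ζ 0 0 := by
      rw [hω]
      simp only
      rw [hsub, ← h2, ← hdX k, map_smul, hr, smul_sub, sub_add_cancel]
    rw [h3, ← hdX k]
    exact (hζ 0 0).smul (ha k) (hm k 0 0) _
  have := (tendsto_hasFun_deformedMetric ha hspatial hΘ h_time χ ω key).sub_const (incl χ)
  simpa [hω] using this

end WarpedFRW

end

theorem mainTheorem3 {ι : Type*} (l : Filter ι) (H : ℝ)
    (a : ι → Fin 4 → ℝ) (q : Fin 4 → ℝ) (Θ : Matrix (Fin 4) (Fin 4) ℝ)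
    (ha : ∀ k μ, a k μ ≠ 0)
    (hspatial : ∀ k k' (i : Fin 3), a k i.succ = a k' i.succ)
    (hq : q ≠ 0)
    (hΘ : Θ.transpose = -Θ)
    (h_time : ∀ i : Fin 3, Tendsto (fun k => WarpedFRW.lower (a k) 0 * Θ 0 i.succ) l (𝓝 0))
    (h_mixed : ∀ k (i : Fin 3), 2 * WarpedFRW.lower (a k) i.succ * Θ 0 i.succ = -H)
    (h_space : ∀ i j : Fin 3, Θ i.succ j.succ = 0) :
    ∃ g : ι → (Fin 4 → ℝ) → Matrix (Fin 4) (Fin 4) ℝ,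
      -- the flat line-element is deformed to the line-element of the metric `g`
      (∀ k, WarpedFRW.IsDeformedMetric (a k) q Θ (g k)) ∧
      -- which is defined on a dense subspace
      Dense {f : WarpedFRW.Hilb | ∃ φ, WarpedFRW.incl φ = f ∧ ∀ k,
        (∃ ξ, WarpedFRW.HasLineElement (a k) q (g k) φ ξ) ∧
        (∃ ξ, WarpedFRW.HasFun (a k) (fun x => g k x 0 0) φ ξ)} ∧
      -- `g` is the Friedmann-Robertson-Walker metric, up to the factor
      -- `exp (-2 a_0 Θ_{0i} x^i)` in the time-time component
      (∀ k x μ ν, g k x μ ν =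
        (if μ = 0 ∧ ν = 0 then
          Real.exp (-2 * ∑ i : Fin 3, WarpedFRW.lower (a k) 0 * Θ 0 i.succ * x i.succ) else 1) *
        WarpedFRW.frwMetric H x μ ν) ∧
      -- as `a_0 Θ_{0i}` tends to zero, `g` tends to the Friedmann-Robertson-Walker metric
      (∀ μ ν, TendstoLocallyUniformly (fun k x => g k x μ ν)
        (fun x => WarpedFRW.frwMetric H x μ ν) l) ∧
      -- the time-time component, as an operator, tends strongly to the identity
      (∀ (ψ : WarpedFRW.Dom) (ξ : ι → WarpedFRW.Hilb),
        (∀ᶠ k in l, WarpedFRW.HasFun (a k) (fun x => g k x 0 0) ψ (ξ k)) →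
        Tendsto ξ l (𝓝 (WarpedFRW.incl ψ))) ∧
      -- the deformed line-element agrees with the Friedmann-Robertson-Walker one up to a
      -- term that is negligible even with respect to `(dX^0)^2`, which is of order `(a_0)^2`
      (∀ (φ : WarpedFRW.Dom) (ξ ξ' : ι → WarpedFRW.Hilb),
        (∀ᶠ k in l, WarpedFRW.HasLineElement (a k) q (g k) φ (ξ k)) →
        (∀ᶠ k in l, WarpedFRW.HasLineElement (a k) q (WarpedFRW.frwMetric H) φ (ξ' k)) →
        Tendsto (fun k => ((WarpedFRW.lower (a k) 0 ^ 2)⁻¹ : ℝ) • (ξ k - ξ' k)) l (𝓝 0)) := by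
  refine ⟨fun k => WarpedFRW.deformedMetric (a k) Θ,
    fun k => WarpedFRW.isDeformedMetric_deformedMetric (ha k) q hΘ,
    WarpedFRW.dense_domain ha q hΘ,
    fun k => WarpedFRW.deformedMetric_eq hΘ (h_mixed k) h_space,
    WarpedFRW.tendstoLocallyUniformly_deformedMetric hΘ h_time h_mixed h_space,
    WarpedFRW.tendsto_hasFun_deformedMetric ha hspatial hΘ h_time,
    WarpedFRW.tendsto_lineElement_sub ha hspatial hΘ h_time h_mixed h_space⟩
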